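/- Let $A_\star,\widehat A\in\mathbb R^{n\times n}$, $B_\star,\widehat B\in\mathbb R^{n\times m}$, and let $R_x\in\mathbb R^{n\times n}$, $R_u\in\mathbb R^{m\times m}$ be symmetric cost matrices with $R_x\succeq I$ and $R_u\succeq I$. A pair $(A,B)$ is called stabilizable if there is $K\in\mathbb R^{m\times n}$ such that all (complex) eigenvalues of $A+BK$ have modulus less than $1$. For stabilizable $(A,B)$ let $P_\infty(A,B)$ be the unique positive semidefinite solution of the discrete algebraic Riccati equation $$P=A^\top PA-A^\top PB(R_u+B^\top PB)^{-1}B^\top PA+R_x,$$ and let $K_\infty(A,B)=-(R_u+B^\top P_\infty(A,B)B)^{-1}B^\top P_\infty(A,B)A$. Write $\|\cdot\|_{\mathrm{op}}$ and $\|\cdot\|_{F}$ for the spectral and the Frobenius norm, and $X^{1/2}$ for the positive semidefinite square root of a positive semidefinite matrix $X$. Suppose that $(A_\star,B_\star)$ is stabilizable, and put $P_\star=P_\infty(A_\star,B_\star)$, $K_\star=K_\infty(A_\star,B_\star)$, $\epsilon_\circ=\max\{\|A_\star-\widehat A\|_\circ,\|B_\star-\widehat B\|_\circ\}$ for $\circ\in\{\mathrm{op},F\}$,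 and $\alpha=8\|P_\star\|_{\mathrm{op}}^2\,\epsilon_{\mathrm{op}}$. If $\alpha<1$, then $(\widehat A,\widehat B)$ is stabilizable (and its Riccati equation has a unique positive semidefinite solution), $$\|P_\infty(\widehat A,\widehat B)\|_{\mathrm{op}}\le(1-\alpha)^{-1/2}\|P_\star\|_{\mathrm{op}},$$ and for both $\circ\in\{\mathrm{op},F\}$ $$\|K_\infty(\widehat A,\widehat B)-K_\star\|_\circ\le7(1-\alpha)^{-7/4}\|P_\star\|_{\mathrm{op}}^{7/2}\,\epsilon_\circ,$$ $$\|R_u^{1/2}(K_\infty(\widehat A,\widehat B)-K_\star)\|_\circ\le7(1-\alpha)^{-7/4}\|P_\star\|_{\mathrm{op}}^{7/2}\,\epsilon_\circ,$$ $$\|B_\star(K_\infty(\widehat A,\widehat B)-K_\star)\|_\circ\le8(1-\alpha)^{-7/4}\|P_\star\|_{\mathrm{op}}^{7/2}\,\epsilon_\circ.$$ In addition, if $\epsilon_{\mathrm{op}}\le32\|P_\star\|_{\mathrm{op}}^3$ (which $\alpha<1$ already implies), then for both $\circ\in\{\mathrm{op},F\}$ $$\|P_\star^{1/2}B_\star(K_\infty(\widehat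 A,\widehat B)-K_\star)\|_\circ\le9(1-\alpha)^{-7/4}\|P_\star\|_{\mathrm{op}}^{7/2}\,\epsilon_\circ.$$ -/

import Mathlib

open scoped Matrix

namespace LQR

noncomputable section

/-- The two matrix norms of interest: the spectral (operator) norm and the Frobenius norm. -/
inductive NormKind where
  | op
  | frob

section
open scoped Matrix.Norms.L2Operator

/-- The spectral norm: the operator norm of `X` between Euclidean spaces. -/
def opNorm {m n : ℕ} (X : Matrix (Fin m) (Fin n) ℝ) : ℝ := ‖X‖

end

section
open scoped Matrix.Norms.Frobenius

/-- The Frobenius norm: the square root of the sum of the squared entries. -/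
def frobNorm {m n : ℕ} (X : Matrix (Fin m) (Fin n) ℝ) : ℝ := ‖X‖

end

def matNorm (c : NormKind) {m n : ℕ} (X : Matrix (Fin m) (Fin n) ℝ) : ℝ :=
  match c with
  | .op => opNorm X
  | .frob => frobNorm X

section
open scoped Matrix.Norms.L2Operator MatrixOrder

/-- The positive semidefinite square root of a positive semidefinite matrix. -/
def psdSqrt {n : ℕ} (X : Matrix (Fin n) (Fin n) ℝ) : Matrix (Fin n) (Fin n) ℝ := CFC.sqrt X

theorem psdSqrt_spec {n : ℕ} {X : Matrix (Fin n) (Fin n) ℝ} (hX : X.PosSemidef) :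
    (psdSqrt X).PosSemidef ∧ psdSqrt X * psdSqrt X = X :=
  ⟨Matrix.nonneg_iff_posSemidef.mp (CFC.sqrt_nonneg X),
    CFC.sqrt_mul_sqrt_self X (Matrix.nonneg_iff_posSemidef.mpr hX)⟩

end

/-- `ρ(X) < 1`, where `ρ(X)` is the largest modulus of a complex eigenvalue of the real
matrix `X`. -/
def IsStable {n : ℕ} (X : Matrix (Fin n) (Fin n) ℝ) : Prop :=
  spectralRadius ℂ (X.map (algebraMap ℝ ℂ)) < 1

/-- `(A, B)` is stabilizable: some linear state feedback `u = K x` makes `A + B K` stable. -/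
def IsStabilizable {n m : ℕ} (A : Matrix (Fin n) (Fin n) ℝ) (B : Matrix (Fin n) (Fin m) ℝ) :
    Prop :=
  ∃ K : Matrix (Fin m) (Fin n) ℝ, IsStable (A + B * K)

/-- `P` is a positive semidefinite solution of the discrete algebraic Riccati equation with
state cost `Rx` and input cost `Ru`. -/
def IsDARESolution {n m : ℕ} (Rx : Matrix (Fin n) (Fin n) ℝ) (Ru : Matrix (Fin m) (Fin m) ℝ)
    (A : Matrix (Fin n) (Fin n) ℝ) (B : Matrix (Fin n) (Fin m) ℝ)
    (P : Matrix (Fin n) (Fin n) ℝ) : Prop :=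
  P.PosSemidef ∧
    P = Aᵀ * P * A - Aᵀ * P * B * (Ru + Bᵀ * P * B)⁻¹ * Bᵀ * P * A + Rx

open Classical in
/-- `P_∞(A, B)`: the positive semidefinite solution of the Riccati equation. It exists and is
unique when `(A, B)` is stabilizable and `Rx`, `Ru` are positive definite; if there is no
solution, the value is the placeholder `0`. -/
def PInf {n m : ℕ} (Rx : Matrix (Fin n) (Fin n) ℝ) (Ru : Matrix (Fin m) (Fin m) ℝ)
    (A : Matrix (Fin n) (Fin n) ℝ) (B : Matrix (Fin n) (Fin m) ℝ) : Matrix (Fin n) (Fin n) ℝ :=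
  if h : ∃ P, IsDARESolution Rx Ru A B P then h.choose else 0

/-- The optimal infinite-horizon controller
`K_∞(A, B) = -(Ru + Bᵀ P_∞(A, B) B)⁻¹ Bᵀ P_∞(A, B) A`. -/
def KInf {n m : ℕ} (Rx : Matrix (Fin n) (Fin n) ℝ) (Ru : Matrix (Fin m) (Fin m) ℝ)
    (A : Matrix (Fin n) (Fin n) ℝ) (B : Matrix (Fin n) (Fin m) ℝ) : Matrix (Fin m) (Fin n) ℝ :=
  -((Ru + Bᵀ * PInf Rx Ru A B * B)⁻¹ * Bᵀ * PInf Rx Ru A B * A)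

/-- `ε_∘ = max {‖A - A'‖_∘, ‖B - B'‖_∘}`. -/
def sysDist (c : NormKind) {n m : ℕ} (A : Matrix (Fin n) (Fin n) ℝ) (B : Matrix (Fin n) (Fin m) ℝ)
    (A' : Matrix (Fin n) (Fin n) ℝ) (B' : Matrix (Fin n) (Fin m) ℝ) : ℝ :=
  max (matNorm c (A - A')) (matNorm c (B - B'))

end

end LQR

open scoped Matrix

namespace LQR

/-! ### Spectral and Frobenius norms -/

section norms

section
open scoped Matrix.Norms.L2Operator

/-! Write `G` for the optimal feedback of `(A, B)`, `M = A + B * G`, and `S = Rx + Gᵀ * Ru * G ≥ 1`,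
so that `P = Mᵀ * P * M + S`. Primes denote the perturbed system, `D = (A' - A) + (B' - B) * G`, and
`‖P‖ = s²`, `‖P'‖ = t²`.

Existence and size. Using `G` on the perturbed system replaces `M` by `M + D`, which changes `Mᵀ * P
* M` by at most `(α / 2) • 1 ≤ (α / 2) • S`. Hence `(1 - α / 2)⁻¹ • P` is a supersolution for the
perturbed system (`IsDARESolution.policyOp_perturbed_le`). A supersolution yields stability
(`isStable_of_lyapunov`) and a Riccati solution (`exists_isDARESolution`), and dominates that
solution (`IsDARESolution.le_of_policyOp_le`). The bound on `‖P'‖` follows.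

Difference of solutions. `IsDARESolution.sub_eq` gives `P' - P = M'ᵀ * (P' - P) * M` plus terms
linear in the system error. Conjugation by `P^(1/2)` makes `M` a strict contraction, of norm at most
`√(1 - 1/s²)`, and likewise for `M'`. So in the weighted difference `P'^(-1/2) * (P' - P) *
P^(-1/2)` the homogeneous term has factor at most `1 - 1/(s t)` and can be absorbed. This gives the
bound `3 s² t² ε` in either norm.

Difference of feedbacks. Let `R' = Ru + B'ᵀ * P' * B'`. Subtracting the stationarity conditions
expresses `R' * (G' - G)` through the quantities above. `R'^(1/2) * (G' - G)` is then bounded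
without any bound on `B'`, because `P'^(1/2) * B' * R'^(-1/2)` is a contraction
(`IsDARESolution.matNorm_weighted_gain_sub_le`). The required bounds come from multiplying by such
contractions and replacing `B'` by `B`. -/

theorem opNorm_nonneg {m n : ℕ} (X : Matrix (Fin m) (Fin n) ℝ) : 0 ≤ opNorm X :=
  norm_nonneg X

theorem opNorm_add_le {m n : ℕ} (X Y : Matrix (Fin m) (Fin n) ℝ) :
    opNorm (X + Y) ≤ opNorm X + opNorm Y :=
  norm_add_le X Y

theorem opNorm_neg {m n : ℕ} (X : Matrix (Fin m) (Fin n) ℝ) : opNorm (-X) = opNorm X :=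
  norm_neg X

theorem opNorm_zero {m n : ℕ} : opNorm (0 : Matrix (Fin m) (Fin n) ℝ) = 0 :=
  norm_zero

theorem continuous_opNorm {m n : ℕ} : Continuous (opNorm : Matrix (Fin m) (Fin n) ℝ → ℝ) :=
  continuous_norm

end

section
open scoped Matrix.Norms.Frobenius

theorem frobNorm_nonneg {m n : ℕ} (X : Matrix (Fin m) (Fin n) ℝ) : 0 ≤ frobNorm X :=
  norm_nonneg X

theorem frobNorm_add_le {m n : ℕ} (X Y : Matrix (Fin m) (Fin n) ℝ) :
    frobNorm (X + Y) ≤ frobNorm X + frobNorm Y :=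
  norm_add_le X Y

theorem frobNorm_neg {m n : ℕ} (X : Matrix (Fin m) (Fin n) ℝ) : frobNorm (-X) = frobNorm X :=
  norm_neg X

theorem frobNorm_zero {m n : ℕ} : frobNorm (0 : Matrix (Fin m) (Fin n) ℝ) = 0 :=
  norm_zero

end

theorem opNorm_transpose {m n : ℕ} (X : Matrix (Fin m) (Fin n) ℝ) : opNorm Xᵀ = opNorm X := by
  unfold opNorm
  rw [← Matrix.conjTranspose_eq_transpose_of_trivial]
  exact Matrix.l2_opNorm_conjTranspose X

theorem frobNorm_transpose {m n : ℕ} (X : Matrix (Fin m) (Fin n) ℝ) :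
    frobNorm Xᵀ = frobNorm X := by
  unfold frobNorm
  exact Matrix.frobenius_norm_transpose X

theorem opNorm_mul_le {l m n : ℕ} (X : Matrix (Fin l) (Fin m) ℝ) (Y : Matrix (Fin m) (Fin n) ℝ) :
    opNorm (X * Y) ≤ opNorm X * opNorm Y := by
  unfold opNorm; exact Matrix.l2_opNorm_mul X Y

theorem matNorm_add_le (c : NormKind) {m n : ℕ} (X Y : Matrix (Fin m) (Fin n) ℝ) :
    matNorm c (X + Y) ≤ matNorm c X + matNorm c Y := by
  cases c
  · exact opNorm_add_le X Y
  · exact frobNorm_add_le X Y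

theorem matNorm_neg (c : NormKind) {m n : ℕ} (X : Matrix (Fin m) (Fin n) ℝ) :
    matNorm c (-X) = matNorm c X := by
  cases c
  · exact opNorm_neg X
  · exact frobNorm_neg X

theorem matNorm_zero (c : NormKind) {m n : ℕ} :
    matNorm c (0 : Matrix (Fin m) (Fin n) ℝ) = 0 := by
  cases c
  · exact opNorm_zero
  · exact frobNorm_zero

theorem matNorm_nonneg (c : NormKind) {m n : ℕ} (X : Matrix (Fin m) (Fin n) ℝ) :
    0 ≤ matNorm c X := by
  cases c
  · exact opNorm_nonneg X
  · exact frobNorm_nonneg X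

theorem matNorm_transpose (c : NormKind) {m n : ℕ} (X : Matrix (Fin m) (Fin n) ℝ) :
    matNorm c Xᵀ = matNorm c X := by
  cases c
  · exact opNorm_transpose X
  · exact frobNorm_transpose X

theorem frobNorm_sq {m n : ℕ} (X : Matrix (Fin m) (Fin n) ℝ) :
    frobNorm X ^ 2 = (Xᵀ * X).trace := by
  unfold frobNorm
  rw [Matrix.frobenius_norm_def, ← Real.sqrt_eq_rpow, Real.sq_sqrt (by positivity)]
  simp only [Matrix.trace, Matrix.diag, Matrix.mul_apply, Matrix.transpose_apply]
  rw [Finset.sum_comm]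
  refine Finset.sum_congr rfl fun i _ => Finset.sum_congr rfl fun j _ => ?_
  rw [Real.rpow_ofNat, Real.norm_eq_abs, sq_abs, sq]

end norms

/-! ### Loewner order and norms -/

section order
open scoped MatrixOrder

variable {l m n : ℕ}

theorem conj_le_conj {X Y : Matrix (Fin m) (Fin m) ℝ} (h : X ≤ Y) (Z : Matrix (Fin m) (Fin n) ℝ) :
    Zᵀ * X * Z ≤ Zᵀ * Y * Z := by
  rw [Matrix.le_iff] at h ⊢
  have := h.conjTranspose_mul_mul_same Z
  rwa [Matrix.conjTranspose_eq_transpose_of_trivial, Matrix.mul_sub, Matrix.sub_mul] at this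

theorem smul_le_smul_matrix {X Y : Matrix (Fin n) (Fin n) ℝ} (h : X ≤ Y) {c : ℝ} (hc : 0 ≤ c) :
    c • X ≤ c • Y := by
  rw [Matrix.le_iff] at h ⊢
  rw [← smul_sub]
  exact h.smul hc

theorem smul_le_smul_matrix_right {X : Matrix (Fin n) (Fin n) ℝ} (h : 0 ≤ X) {c d : ℝ}
    (hc : c ≤ d) : c • X ≤ d • X := by
  rw [Matrix.le_iff, ← sub_smul]
  exact (Matrix.nonneg_iff_posSemidef.mp h).smul (sub_nonneg.mpr hc)

theorem transpose_eq_of_nonneg {X : Matrix (Fin n) (Fin n) ℝ} (h : 0 ≤ X) : Xᵀ = X := by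
  have := (Matrix.nonneg_iff_posSemidef.mp h).isHermitian
  rwa [Matrix.IsHermitian, Matrix.conjTranspose_eq_transpose_of_trivial] at this

theorem one_nonneg_matrix : (0 : Matrix (Fin n) (Fin n) ℝ) ≤ 1 :=
  Matrix.nonneg_iff_posSemidef.mpr Matrix.PosSemidef.one

theorem le_iff_dotProduct {X Y : Matrix (Fin n) (Fin n) ℝ} (hX : Xᵀ = X) (hY : Yᵀ = Y) :
    X ≤ Y ↔ ∀ v : Fin n → ℝ, v ⬝ᵥ (X *ᵥ v) ≤ v ⬝ᵥ (Y *ᵥ v) := by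
  rw [Matrix.le_iff, Matrix.posSemidef_iff_dotProduct_mulVec]
  have : (Y - X).IsHermitian := by
    rw [Matrix.IsHermitian, Matrix.conjTranspose_eq_transpose_of_trivial, Matrix.transpose_sub,
      hX, hY]
  simp only [this, true_and, Matrix.sub_mulVec, dotProduct_sub, star_trivial, sub_nonneg]

open scoped Matrix.Norms.L2Operator in
theorem mulVec_dotProduct_self_le (X : Matrix (Fin m) (Fin n) ℝ) (v : Fin n → ℝ) :
    (X *ᵥ v) ⬝ᵥ (X *ᵥ v) ≤ opNorm X ^ 2 * (v ⬝ᵥ v) := by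
  have h := Matrix.l2_opNorm_mulVec X (WithLp.toLp 2 v)
  have h2 := pow_le_pow_left₀ (norm_nonneg _) h 2
  rw [mul_pow, EuclideanSpace.real_norm_sq_eq, EuclideanSpace.real_norm_sq_eq] at h2
  simpa [dotProduct, sq, opNorm] using h2

theorem opNorm_le_of_transpose_mul_self_le {X : Matrix (Fin m) (Fin n) ℝ} {c : ℝ} (hc : 0 ≤ c)
    (h : Xᵀ * X ≤ c ^ 2 • 1) : opNorm X ≤ c := by
  rw [le_iff_dotProduct (by simp) (by simp)] at h
  unfold opNorm
  rw [Matrix.l2_opNorm_def]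
  refine ContinuousLinearMap.opNorm_le_bound _ hc fun v => ?_
  refine le_of_sq_le_sq ?_ (by positivity)
  rw [mul_pow, EuclideanSpace.real_norm_sq_eq, EuclideanSpace.real_norm_sq_eq]
  have := h v.ofLp
  rw [← Matrix.mulVec_mulVec, Matrix.dotProduct_mulVec, Matrix.vecMul_transpose,
    Matrix.smul_mulVec, Matrix.one_mulVec, dotProduct_smul] at this
  simpa [dotProduct, sq] using this

theorem transpose_mul_self_le (X : Matrix (Fin m) (Fin n) ℝ) :
    Xᵀ * X ≤ opNorm X ^ 2 • (1 : Matrix (Fin n) (Fin n) ℝ) := by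
  rw [le_iff_dotProduct (by simp) (by simp)]
  intro v
  rw [← Matrix.mulVec_mulVec, Matrix.dotProduct_mulVec, Matrix.vecMul_transpose,
    Matrix.smul_mulVec, Matrix.one_mulVec, dotProduct_smul]
  exact mulVec_dotProduct_self_le X v

theorem le_opNorm_smul_one {X : Matrix (Fin n) (Fin n) ℝ} (hX : Xᵀ = X) :
    X ≤ opNorm X • (1 : Matrix (Fin n) (Fin n) ℝ) := by
  rw [le_iff_dotProduct hX (by simp)]
  intro v
  rw [Matrix.smul_mulVec, Matrix.one_mulVec, dotProduct_smul, smul_eq_mul]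
  have h1 := mulVec_dotProduct_self_le X v
  have h2 : (v ⬝ᵥ (X *ᵥ v)) ^ 2 ≤ (v ⬝ᵥ v) * ((X *ᵥ v) ⬝ᵥ (X *ᵥ v)) := by
    have := Finset.sum_mul_sq_le_sq_mul_sq Finset.univ v (X *ᵥ v)
    simpa [dotProduct, sq] using this
  have h3 : 0 ≤ v ⬝ᵥ v := by simpa using dotProduct_star_self_nonneg v
  refine le_of_sq_le_sq ?_ (mul_nonneg (opNorm_nonneg X) h3)
  nlinarith

/-- Conjugating `X ≤ c` by `X^(1/2)` gives `X² ≤ c X ≤ c²`. -/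
theorem opNorm_le_of_le_smul_one {X : Matrix (Fin n) (Fin n) ℝ} (hX : 0 ≤ X) {c : ℝ} (hc : 0 ≤ c)
    (h : X ≤ c • 1) : opNorm X ≤ c := by
  have hT := transpose_eq_of_nonneg hX
  refine opNorm_le_of_transpose_mul_self_le hc ?_
  obtain ⟨hs, hss⟩ := psdSqrt_spec (Matrix.nonneg_iff_posSemidef.mp hX)
  have hsT := transpose_eq_of_nonneg (Matrix.nonneg_iff_posSemidef.mpr hs)
  have h1 := conj_le_conj h (psdSqrt X)
  have e1 : (psdSqrt X)ᵀ * X * psdSqrt X = Xᵀ * X := by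
    rw [hsT, hT]
    nth_rw 2 [← hss]
    rw [Matrix.mul_assoc, Matrix.mul_assoc, hss, ← Matrix.mul_assoc, hss]
  have e2 : (psdSqrt X)ᵀ * (c • 1 : Matrix (Fin n) (Fin n) ℝ) * psdSqrt X = c • X := by
    rw [hsT, Matrix.mul_smul, Matrix.mul_one, Matrix.smul_mul, hss]
  rw [e1, e2] at h1
  refine h1.trans ((smul_le_smul_matrix h hc).trans_eq ?_)
  rw [smul_smul, sq]

theorem opNorm_mono {X Y : Matrix (Fin n) (Fin n) ℝ} (hX : 0 ≤ X) (h : X ≤ Y) :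
    opNorm X ≤ opNorm Y :=
  opNorm_le_of_le_smul_one hX (opNorm_nonneg Y)
    (h.trans (le_opNorm_smul_one (transpose_eq_of_nonneg (hX.trans h))))

theorem trace_le_trace {X Y : Matrix (Fin n) (Fin n) ℝ} (h : X ≤ Y) : X.trace ≤ Y.trace := by
  have := (Matrix.le_iff.mp h).trace_nonneg
  rw [Matrix.trace_sub] at this
  linarith

/-- Conjugate `Xᵀ * X ≤ ‖X‖²` by `Y` and take traces. This mixed bound lets both norms be treated at
once. -/
theorem frobNorm_mul_le (X : Matrix (Fin l) (Fin m) ℝ) (Y : Matrix (Fin m) (Fin n) ℝ) :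
    frobNorm (X * Y) ≤ opNorm X * frobNorm Y := by
  refine le_of_sq_le_sq ?_ (mul_nonneg (opNorm_nonneg X) (frobNorm_nonneg Y))
  rw [mul_pow, frobNorm_sq, frobNorm_sq]
  have := trace_le_trace (conj_le_conj (transpose_mul_self_le X) Y)
  simpa [Matrix.transpose_mul, Matrix.mul_assoc, Matrix.trace_smul] using this

theorem matNorm_mul_le_left (c : NormKind) (X : Matrix (Fin l) (Fin m) ℝ)
    (Y : Matrix (Fin m) (Fin n) ℝ) : matNorm c (X * Y) ≤ opNorm X * matNorm c Y := by
  cases c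
  · exact opNorm_mul_le X Y
  · exact frobNorm_mul_le X Y

theorem matNorm_mul_le_right (c : NormKind) (X : Matrix (Fin l) (Fin m) ℝ)
    (Y : Matrix (Fin m) (Fin n) ℝ) : matNorm c (X * Y) ≤ matNorm c X * opNorm Y := by
  rw [← matNorm_transpose, Matrix.transpose_mul, mul_comm, ← matNorm_transpose c X,
    ← opNorm_transpose Y]
  exact matNorm_mul_le_left c _ _

end order

/-! ### Lyapunov inequalities and stability -/

section lyapunov
open scoped MatrixOrder
open Filter Topology

variable {l m n : ℕ}

theorem isClosed_le_matrix {α : Type*} [TopologicalSpace α] {f g : α → Matrix (Fin n) (Fin n) ℝ}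
    (hf : Continuous f) (hg : Continuous g) : IsClosed {a | f a ≤ g a} := by
  have : {a | f a ≤ g a} = {a | (g a - f a)ᵀ = g a - f a} ∩
      ⋂ v : Fin n → ℝ, {a | 0 ≤ v ⬝ᵥ ((g a - f a) *ᵥ v)} := by
    ext a
    simp only [Set.mem_ofPred_eq, Matrix.le_iff, Matrix.posSemidef_iff_dotProduct_mulVec,
      Matrix.IsHermitian, Matrix.conjTranspose_eq_transpose_of_trivial, star_trivial,
      Set.mem_inter_iff, Set.mem_iInter]
  rw [this]
  refine (isClosed_eq ?_ ?_).inter (isClosed_iInter fun v => isClosed_le ?_ ?_) <;> fun_prop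

theorem le_of_tendsto_matrix {f : ℕ → Matrix (Fin n) (Fin n) ℝ} {X Y : Matrix (Fin n) (Fin n) ℝ}
    (hf : Tendsto f atTop (𝓝 X)) (h : ∀ k, Y ≤ f k) : Y ≤ X :=
  (isClosed_le_matrix continuous_const continuous_id).mem_of_tendsto hf
    (Eventually.of_forall h)

/-- A strict Lyapunov inequality `Mᵀ X M + S ≤ X` with `S ≥ 1` gives geometric decrease. -/
theorem exists_contraction {M X S : Matrix (Fin n) (Fin n) ℝ} (hS : 1 ≤ S) (hX0 : 0 ≤ X)
    (hX : Mᵀ * X * M + S ≤ X) : 1 ≤ X ∧ ∃ q : ℝ, 0 ≤ q ∧ q < 1 ∧ Mᵀ * X * M ≤ q • X := by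
  have h0 : 0 ≤ Mᵀ * X * M := by simpa using conj_le_conj hX0 M
  have h1 : 1 ≤ X := hS.trans ((le_add_of_nonneg_left h0).trans hX)
  -- `X ≤ (‖X‖ + 1) • 1` and `1 ≤ S` give `S ≥ X / (‖X‖ + 1)`. The added 1 keeps the denominator
  -- positive in dimension zero.
  refine ⟨h1, 1 - 1 / (opNorm X + 1), ?_, ?_, ?_⟩
  · have := opNorm_nonneg X
    rw [sub_nonneg, div_le_one (by linarith)]; linarith
  · have : 0 < 1 / (opNorm X + 1) := by have := opNorm_nonneg X; positivity
    linarith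
  · have hp : 0 < opNorm X + 1 := by have := opNorm_nonneg X; linarith
    have h2 : X ≤ (opNorm X + 1) • 1 :=
      (le_opNorm_smul_one (transpose_eq_of_nonneg hX0)).trans
        (smul_le_smul_matrix_right one_nonneg_matrix (by linarith))
    have h3 : (1 / (opNorm X + 1)) • X ≤ S := by
      refine (smul_le_smul_matrix h2 (by positivity)).trans ?_
      rw [smul_smul, one_div_mul_cancel hp.ne', one_smul]; exact hS
    rw [sub_smul, one_smul, le_sub_iff_add_le]
    exact (add_le_add le_rfl h3).trans hX

theorem pow_conj_le {M X : Matrix (Fin n) (Fin n) ℝ} {q : ℝ} (hq : 0 ≤ q)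
    (h : Mᵀ * X * M ≤ q • X) (k : ℕ) : (M ^ k)ᵀ * X * M ^ k ≤ q ^ k • X := by
  induction k with
  | zero => simp
  | succ k ih =>
    have := conj_le_conj ih M
    rw [Matrix.mul_smul, Matrix.smul_mul] at this
    replace := this.trans (smul_le_smul_matrix h (pow_nonneg hq k))
    rw [smul_smul, ← pow_succ] at this
    refine le_trans (le_of_eq ?_) this
    rw [pow_succ, Matrix.transpose_mul]
    simp only [Matrix.mul_assoc]

/-- Comparison of sub- and supersolutions of a Lyapunov equation. -/
theorem le_of_lyapunov {M X S Y : Matrix (Fin n) (Fin n) ℝ} (hS : 1 ≤ S) (hX0 : 0 ≤ X)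
    (hX : Mᵀ * X * M + S ≤ X) (hYT : Yᵀ = Y) (hY : Y ≤ Mᵀ * Y * M + S) : Y ≤ X := by
  obtain ⟨h1, q, hq0, hq1, hq⟩ := exists_contraction hS hX0 hX
  have hXT := transpose_eq_of_nonneg hX0
  set c := opNorm (Y - X)
  have hstep : Y - X ≤ Mᵀ * (Y - X) * M := by
    rw [Matrix.mul_sub, Matrix.sub_mul]
    have := sub_le_sub hY hX
    rwa [add_sub_add_right_eq_sub] at this
  -- `Y - X` is a subsolution of the homogeneous equation, so each iteration gains a factor `q`; the
  -- start uses `Y - X ≤ c • 1 ≤ c • X`.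
  have key : ∀ k : ℕ, Y - X ≤ (c * q ^ k) • X := by
    intro k
    induction k with
    | zero =>
      rw [pow_zero, mul_one]
      exact (le_opNorm_smul_one (by rw [Matrix.transpose_sub, hYT, hXT])).trans
        (smul_le_smul_matrix h1 (opNorm_nonneg _))
    | succ k ih =>
      refine hstep.trans ((conj_le_conj ih M).trans ?_)
      rw [Matrix.mul_smul, Matrix.smul_mul, pow_succ, ← mul_assoc, mul_smul (c * q ^ k) q X]
      exact smul_le_smul_matrix hq (mul_nonneg (opNorm_nonneg _) (pow_nonneg hq0 k))
  have hlim : Tendsto (fun k : ℕ => (c * q ^ k) • X) atTop (𝓝 ((c * 0) • X)) :=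
    ((tendsto_pow_atTop_nhds_zero_of_lt_one hq0 hq1).const_mul c).smul_const X
  have := le_of_tendsto_matrix hlim key
  rw [mul_zero, zero_smul] at this
  exact sub_nonpos.mp this

-- Geometric decrease of `(M ^ k)ᵀ * X * M ^ k` together with `1 ≤ X` forces `M ^ k → 0`, and the
-- spectral radius is controlled by the norm of a single power.
open scoped Matrix.Norms.Frobenius in
theorem isStable_of_lyapunov {M X S : Matrix (Fin n) (Fin n) ℝ} (hS : 1 ≤ S) (hX0 : 0 ≤ X)
    (hX : Mᵀ * X * M + S ≤ X) : IsStable M := by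
  obtain ⟨h1, q, hq0, hq1, hq⟩ := exists_contraction hS hX0 hX
  have hbound : ∀ k : ℕ, frobNorm (M ^ k) ^ 2 ≤ q ^ k * X.trace := by
    intro k
    rw [frobNorm_sq, ← smul_eq_mul (q ^ k), ← Matrix.trace_smul]
    refine trace_le_trace (le_trans ?_ (pow_conj_le hq0 hq k))
    simpa using conj_le_conj h1 (M ^ k)
  have hlim : Tendsto (fun k : ℕ => frobNorm (M ^ k) ^ 2) atTop (𝓝 0) := by
    refine squeeze_zero (fun k => sq_nonneg _) hbound ?_
    simpa using (tendsto_pow_atTop_nhds_zero_of_lt_one hq0 hq1).mul_const X.trace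
  let _ : NormedRing (Matrix (Fin n) (Fin n) ℂ) := Matrix.frobeniusNormedRing
  let _ : NormedAlgebra ℂ (Matrix (Fin n) (Fin n) ℂ) := Matrix.frobeniusNormedAlgebra
  have hmap : ∀ k : ℕ, ‖(M.map (algebraMap ℝ ℂ)) ^ k‖ = frobNorm (M ^ k) := by
    intro k
    have : (M.map (algebraMap ℝ ℂ)) ^ k = (M ^ k).map (algebraMap ℝ ℂ) :=
      ((algebraMap ℝ ℂ).mapMatrix.map_pow M k).symm
    rw [this]
    exact Matrix.frobenius_norm_map_eq _ _ (fun a => by simp)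
  have hlim2 : Tendsto (fun k : ℕ => ‖(M.map (algebraMap ℝ ℂ)) ^ k‖) atTop (𝓝 0) := by
    have := hlim.sqrt
    simp only [hmap]
    simpa [Real.sqrt_sq (frobNorm_nonneg _)] using this
  -- The power bound for the spectral radius carries a factor `‖1‖`, which need not be 1 in the
  -- Frobenius norm.
  have hev : ∀ᶠ k : ℕ in atTop, ‖(M.map (algebraMap ℝ ℂ)) ^ k‖ <
      1 / (‖(1 : Matrix (Fin n) (Fin n) ℂ)‖ + 1) :=
    hlim2.eventually_lt_const (by positivity)
  obtain ⟨k, hk⟩ := (eventually_atTop.mp hev)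
  have hk1 := hk (k + 1) (Nat.le_succ k)
  have := spectrum.spectralRadius_le_pow_nnnorm_pow_one_div ℂ (M.map (algebraMap ℝ ℂ)) k
  refine this.trans_lt ?_
  rw [← ENNReal.mul_rpow_of_nonneg _ _ (by positivity)]
  refine ENNReal.rpow_lt_one ?_ (by positivity)
  rw [← ENNReal.coe_mul, ENNReal.coe_lt_one_iff, ← NNReal.coe_lt_coe]
  push_cast
  have h1n : 0 ≤ ‖(1 : Matrix (Fin n) (Fin n) ℂ)‖ := norm_nonneg _
  rw [lt_div_iff₀ (by linarith)] at hk1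
  have := norm_nonneg ((M.map (algebraMap ℝ ℂ)) ^ (k + 1))
  nlinarith

-- By Gelfand's formula, `‖M ^ k‖` is eventually at most `r ^ k` for some `r < 1`.
open scoped Matrix.Norms.Frobenius in
theorem tendsto_pow_of_isStable {M : Matrix (Fin n) (Fin n) ℝ} (hM : IsStable M) :
    Tendsto (fun k : ℕ => M ^ k) atTop (𝓝 0) := by
  let _ : NormedRing (Matrix (Fin n) (Fin n) ℂ) := Matrix.frobeniusNormedRing
  let _ : NormedAlgebra ℂ (Matrix (Fin n) (Fin n) ℂ) := Matrix.frobeniusNormedAlgebra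
  have : CompleteSpace (Matrix (Fin n) (Fin n) ℂ) := FiniteDimensional.complete ℂ _
  have hmap : ∀ k : ℕ, ‖(M.map (algebraMap ℝ ℂ)) ^ k‖ = ‖M ^ k‖ := by
    intro k
    have : (M.map (algebraMap ℝ ℂ)) ^ k = (M ^ k).map (algebraMap ℝ ℂ) :=
      ((algebraMap ℝ ℂ).mapMatrix.map_pow M k).symm
    rw [this]
    exact Matrix.frobenius_norm_map_eq _ _ (fun a => by simp)
  obtain ⟨r, hr1, hr2⟩ := ENNReal.lt_iff_exists_nnreal_btwn.mp hM
  have hg := spectrum.pow_nnnorm_pow_one_div_tendsto_nhds_spectralRadius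
    (M.map (algebraMap ℝ ℂ))
  have hev := hg.eventually_lt_const hr1
  refine tendsto_zero_iff_norm_tendsto_zero.mpr ?_
  have hr3 : (r : ℝ) < 1 := by exact_mod_cast hr2
  refine squeeze_zero' (Eventually.of_forall fun k => norm_nonneg _) ?_
    (tendsto_pow_atTop_nhds_zero_of_lt_one r.coe_nonneg hr3)
  filter_upwards [hev, eventually_gt_atTop 0] with k hk hk0
  rw [one_div, ENNReal.rpow_inv_lt_iff (by exact_mod_cast hk0), ENNReal.rpow_natCast] at hk
  rw [← hmap]
  exact_mod_cast hk.le

/-- A finite piece of the series `∑ (M ^ j)ᵀ * S * M ^ j` suffices: once its next term is at most `S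
/ 2`, twice the partial sum is a supersolution. -/
theorem exists_lyapunov_of_isStable {M S : Matrix (Fin n) (Fin n) ℝ} (hM : IsStable M)
    (hS : 1 ≤ S) : ∃ X, 0 ≤ X ∧ Mᵀ * X * M + S ≤ X := by
  have hS0 : 0 ≤ S := one_nonneg_matrix.trans hS
  have hlim := tendsto_pow_of_isStable hM
  have hcont : Continuous fun Z : Matrix (Fin n) (Fin n) ℝ => opNorm (Zᵀ * S * Z) :=
    continuous_opNorm.comp (by fun_prop)
  have hlim2 := (hcont.tendsto 0).comp hlim
  have hz : opNorm ((0 : Matrix (Fin n) (Fin n) ℝ)ᵀ * S * 0) = 0 := by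
    rw [Matrix.mul_zero, opNorm_zero]
  rw [hz] at hlim2
  obtain ⟨k, hk⟩ := (hlim2.eventually_lt_const (show (0 : ℝ) < 1 / 2 by norm_num)).exists
  simp only [Function.comp] at hk
  have hpow : (M ^ k)ᵀ * S * M ^ k ≤ (1 / 2 : ℝ) • S := by
    have h0 : 0 ≤ (M ^ k)ᵀ * S * M ^ k := by simpa using conj_le_conj hS0 (M ^ k)
    refine (le_opNorm_smul_one (transpose_eq_of_nonneg h0)).trans ?_
    exact (smul_le_smul_matrix_right one_nonneg_matrix hk.le).trans
      (smul_le_smul_matrix hS (by norm_num))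
  set Y := ∑ j ∈ Finset.range k, (M ^ j)ᵀ * S * M ^ j
  have hY0 : 0 ≤ Y := Finset.sum_nonneg fun j _ => by simpa using conj_le_conj hS0 (M ^ j)
  have hYM : Mᵀ * Y * M + S = Y + (M ^ k)ᵀ * S * M ^ k := by
    rw [← Finset.sum_range_succ, Finset.sum_range_succ', Matrix.mul_sum, Matrix.sum_mul]
    simp [pow_succ, Matrix.transpose_mul, Matrix.mul_assoc]
  refine ⟨(2 : ℝ) • Y, by simpa using smul_le_smul_matrix hY0 (show (0 : ℝ) ≤ 2 by norm_num), ?_⟩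
  have h1 : Mᵀ * Y * M + S ≤ Y + (1 / 2 : ℝ) • S := hYM.trans_le (add_le_add le_rfl hpow)
  have h2 := smul_le_smul_matrix h1 (show (0 : ℝ) ≤ 2 by norm_num)
  rw [smul_add, smul_add, smul_smul, two_smul ℝ S] at h2
  norm_num at h2
  rw [Matrix.mul_smul, Matrix.smul_mul]
  rwa [← add_assoc, add_le_add_iff_right] at h2

end lyapunov

/-! ### Riccati equation: optimality, uniqueness, existence -/

section riccati
open scoped MatrixOrder

variable {m n : ℕ}

/-- The Bellman operator of the fixed feedback `K`. -/
def policyOp (Rx : Matrix (Fin n) (Fin n) ℝ) (Ru : Matrix (Fin m) (Fin m) ℝ)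
    (A : Matrix (Fin n) (Fin n) ℝ) (B : Matrix (Fin n) (Fin m) ℝ) (K : Matrix (Fin m) (Fin n) ℝ)
    (P : Matrix (Fin n) (Fin n) ℝ) : Matrix (Fin n) (Fin n) ℝ :=
  (A + B * K)ᵀ * P * (A + B * K) + (Rx + Kᵀ * Ru * K)

/-- The feedback that is greedy for the value function `P`. -/
noncomputable def gain (Ru : Matrix (Fin m) (Fin m) ℝ) (A : Matrix (Fin n) (Fin n) ℝ)
    (B : Matrix (Fin n) (Fin m) ℝ) (P : Matrix (Fin n) (Fin n) ℝ) : Matrix (Fin m) (Fin n) ℝ :=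
  -((Ru + Bᵀ * P * B)⁻¹ * Bᵀ * P * A)

variable {Rx : Matrix (Fin n) (Fin n) ℝ} {Ru : Matrix (Fin m) (Fin m) ℝ}
  {A : Matrix (Fin n) (Fin n) ℝ} {B : Matrix (Fin n) (Fin m) ℝ} {P : Matrix (Fin n) (Fin n) ℝ}

theorem isUnit_det_of_one_le {X : Matrix (Fin n) (Fin n) ℝ} (h : 1 ≤ X) : IsUnit X.det := by
  have h1 : (1 + (X - 1)).PosDef := Matrix.PosDef.one.add_posSemidef (Matrix.le_iff.mp h)
  rw [add_sub_cancel] at h1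
  exact (Matrix.isUnit_iff_isUnit_det _).mp h1.isUnit

theorem one_le_inputWeight (hRu : 1 ≤ Ru) (hP : 0 ≤ P) (B : Matrix (Fin n) (Fin m) ℝ) :
    1 ≤ Ru + Bᵀ * P * B :=
  hRu.trans (le_add_of_nonneg_right (by simpa using conj_le_conj hP B))

theorem transpose_eq_of_one_le {X : Matrix (Fin n) (Fin n) ℝ} (h : 1 ≤ X) : Xᵀ = X :=
  transpose_eq_of_nonneg (one_nonneg_matrix.trans h)

theorem one_le_stageCost (hRx : 1 ≤ Rx) (hRu : 1 ≤ Ru) (K : Matrix (Fin m) (Fin n) ℝ) :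
    1 ≤ Rx + Kᵀ * Ru * K :=
  hRx.trans (le_add_of_nonneg_right (by
    simpa using conj_le_conj (one_nonneg_matrix.trans hRu) K))

theorem inputWeight_mul_gain (hRu : 1 ≤ Ru) (hP : 0 ≤ P) :
    (Ru + Bᵀ * P * B) * gain Ru A B P = -(Bᵀ * P * A) := by
  have hu := isUnit_det_of_one_le (one_le_inputWeight hRu hP B)
  rw [gain, Matrix.mul_neg, Matrix.mul_assoc _ Bᵀ P, Matrix.mul_assoc _ (Bᵀ * P) A,
    Matrix.mul_nonsing_inv_cancel_left _ _ hu]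

/-- Stationarity of the greedy feedback. -/
theorem gain_stationary (hRu : 1 ≤ Ru) (hP : 0 ≤ P) :
    Bᵀ * P * (A + B * gain Ru A B P) + Ru * gain Ru A B P = 0 := by
  have h := inputWeight_mul_gain (A := A) (B := B) hRu hP
  rw [Matrix.add_mul] at h
  rw [Matrix.mul_add, ← Matrix.mul_assoc, add_assoc,
    add_comm (Bᵀ * P * B * gain Ru A B P), h, add_neg_cancel]

theorem policyOp_mono (K : Matrix (Fin m) (Fin n) ℝ) {P Q : Matrix (Fin n) (Fin n) ℝ}
    (h : P ≤ Q) : policyOp Rx Ru A B K P ≤ policyOp Rx Ru A B K Q :=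
  add_le_add (conj_le_conj h _) le_rfl

/-- The cost of `K` splits along the greedy feedback. -/
theorem policyOp_eq_cross (hRu : 1 ≤ Ru) (hP : 0 ≤ P) (K : Matrix (Fin m) (Fin n) ℝ) :
    (A + B * K)ᵀ * P * (A + B * gain Ru A B P) + (Rx + Kᵀ * Ru * gain Ru A B P) =
      Aᵀ * P * (A + B * gain Ru A B P) + Rx := by
  have h := congrArg (fun Z => Kᵀ * Z) (gain_stationary (A := A) (B := B) hRu hP)
  simp only [Matrix.mul_add Kᵀ, Matrix.mul_zero] at h
  rw [Matrix.transpose_add, Matrix.transpose_mul, Matrix.add_mul, Matrix.add_mul]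
  simp only [Matrix.mul_assoc] at h ⊢
  rw [add_assoc, add_left_comm _ Rx, h, add_zero]

theorem riccati_eq_cross (Rx : Matrix (Fin n) (Fin n) ℝ) (Ru : Matrix (Fin m) (Fin m) ℝ)
    (A : Matrix (Fin n) (Fin n) ℝ) (B : Matrix (Fin n) (Fin m) ℝ) (P : Matrix (Fin n) (Fin n) ℝ) :
    Aᵀ * P * A - Aᵀ * P * B * (Ru + Bᵀ * P * B)⁻¹ * Bᵀ * P * A + Rx =
      Aᵀ * P * (A + B * gain Ru A B P) + Rx := by
  rw [gain, Matrix.mul_neg, Matrix.mul_add, Matrix.mul_neg, sub_eq_add_neg]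
  simp only [Matrix.mul_assoc]

theorem policyOp_gain (hRu : 1 ≤ Ru) (hP : 0 ≤ P) :
    policyOp Rx Ru A B (gain Ru A B P) P =
      Aᵀ * P * (A + B * gain Ru A B P) + Rx :=
  policyOp_eq_cross hRu hP _

/-- The greedy feedback minimizes the one-step cost. -/
theorem policyOp_gain_le (hRu : 1 ≤ Ru) (hP : 0 ≤ P) (K : Matrix (Fin m) (Fin n) ℝ) :
    policyOp Rx Ru A B (gain Ru A B P) P ≤ policyOp Rx Ru A B K P := by
  set G := gain Ru A B P with hG
  have hPT := transpose_eq_of_nonneg hP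
  have hRuT := transpose_eq_of_one_le hRu
  have hst := gain_stationary (A := A) (B := B) hRu hP
  rw [← hG] at hst
  have h0 : 0 ≤ (K - G)ᵀ * (Ru + Bᵀ * P * B) * (K - G) := by
    simpa using conj_le_conj (one_nonneg_matrix.trans (one_le_inputWeight hRu hP B)) (K - G)
  have e1 := congrArg (fun Z => (K - G)ᵀ * Z) hst
  have e2 := congrArg Matrix.transpose e1
  -- Completing the square around `G`: the cross terms contain the stationarity expression and
  -- vanish.
  have key : policyOp Rx Ru A B K P = policyOp Rx Ru A B G P +
      (K - G)ᵀ * (Ru + Bᵀ * P * B) * (K - G) +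
      (K - G)ᵀ * (Bᵀ * P * (A + B * G) + Ru * G) +
      ((K - G)ᵀ * (Bᵀ * P * (A + B * G) + Ru * G))ᵀ := by
    simp only [policyOp, Matrix.transpose_add, Matrix.transpose_mul, Matrix.transpose_sub,
      Matrix.transpose_transpose, hPT, hRuT, Matrix.mul_add, Matrix.add_mul, Matrix.mul_sub,
      Matrix.sub_mul, Matrix.mul_assoc]
    abel
  simp only [hst, Matrix.mul_zero, Matrix.transpose_zero, add_zero] at key
  rw [key]
  exact le_add_of_nonneg_right h0

theorem isDARESolution_iff (hRu : 1 ≤ Ru) :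
    IsDARESolution Rx Ru A B P ↔ 0 ≤ P ∧ policyOp Rx Ru A B (gain Ru A B P) P = P := by
  rw [IsDARESolution, riccati_eq_cross, Matrix.nonneg_iff_posSemidef]
  refine and_congr_right fun h => ?_
  rw [policyOp_gain hRu (Matrix.nonneg_iff_posSemidef.mpr h), eq_comm]

/-- A Riccati solution is below every supersolution of every feedback. -/
theorem IsDARESolution.le_of_policyOp_le (hRx : 1 ≤ Rx) (hRu : 1 ≤ Ru)
    (h : IsDARESolution Rx Ru A B P) {X : Matrix (Fin n) (Fin n) ℝ} (hX0 : 0 ≤ X)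
    {K : Matrix (Fin m) (Fin n) ℝ} (hX : policyOp Rx Ru A B K X ≤ X) : P ≤ X := by
  obtain ⟨hP, he⟩ := (isDARESolution_iff hRu).mp h
  -- By greediness `P` is a subsolution for the arbitrary feedback `K`, so the Lyapunov comparison
  -- applies.
  refine le_of_lyapunov (one_le_stageCost hRx hRu K) hX0 hX (transpose_eq_of_nonneg hP) ?_
  conv_lhs => rw [← he]
  exact policyOp_gain_le hRu hP K

/-- Each solution is a supersolution for its own greedy feedback, hence dominates the other. -/
theorem IsDARESolution.unique (hRx : 1 ≤ Rx) (hRu : 1 ≤ Ru) {Q : Matrix (Fin n) (Fin n) ℝ}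
    (hP : IsDARESolution Rx Ru A B P) (hQ : IsDARESolution Rx Ru A B Q) : P = Q :=
  le_antisymm
    (hP.le_of_policyOp_le hRx hRu ((isDARESolution_iff hRu).mp hQ).1
      ((isDARESolution_iff hRu).mp hQ).2.le)
    (hQ.le_of_policyOp_le hRx hRu ((isDARESolution_iff hRu).mp hP).1
      ((isDARESolution_iff hRu).mp hP).2.le)

open scoped Matrix.Norms.L2Operator in
theorem isCompact_matrix_Icc (X : Matrix (Fin n) (Fin n) ℝ) :
    IsCompact {P : Matrix (Fin n) (Fin n) ℝ | 0 ≤ P ∧ P ≤ X} := by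
  have : FiniteDimensional ℝ (Matrix (Fin n) (Fin n) ℝ) := inferInstance
  have : ProperSpace (Matrix (Fin n) (Fin n) ℝ) := FiniteDimensional.proper ℝ _
  refine Metric.isCompact_of_isClosed_isBounded ?_ ?_
  · exact (isClosed_le_matrix continuous_const continuous_id).inter
      (isClosed_le_matrix continuous_id continuous_const)
  · refine (Metric.isBounded_iff_subset_closedBall 0).mpr ⟨opNorm X, fun P hP => ?_⟩
    rw [mem_closedBall_zero_iff]
    exact opNorm_mono hP.1 hP.2

/-- Among the `P` between 0 and `X` that are subsolutions for every feedback, a compact set, take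
one of maximal trace. One step of value iteration stays in the set and only increases `P`, so
maximality makes `P` a fixed point. -/
theorem exists_isDARESolution (hRx : 1 ≤ Rx) (hRu : 1 ≤ Ru) {X : Matrix (Fin n) (Fin n) ℝ}
    (hX0 : 0 ≤ X) {K : Matrix (Fin m) (Fin n) ℝ} (hX : policyOp Rx Ru A B K X ≤ X) :
    ∃ P, IsDARESolution Rx Ru A B P := by
  set s : Set (Matrix (Fin n) (Fin n) ℝ) :=
    {P | 0 ≤ P ∧ P ≤ X} ∩ ⋂ L : Matrix (Fin m) (Fin n) ℝ, {P | P ≤ policyOp Rx Ru A B L P}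
    with hs
  have hcomp : IsCompact s := by
    refine (isCompact_matrix_Icc X).inter_right (isClosed_iInter fun L => ?_)
    exact isClosed_le_matrix continuous_id (by unfold policyOp; fun_prop)
  have hne : s.Nonempty := by
    refine ⟨0, ⟨le_rfl, hX0⟩, Set.mem_iInter.mpr fun L => ?_⟩
    simpa [policyOp] using one_nonneg_matrix.trans (one_le_stageCost hRx hRu L)
  obtain ⟨P, hPs, hmax⟩ := hcomp.exists_isMaxOn hne
    (f := Matrix.trace) (Continuous.continuousOn (by fun_prop))
  obtain ⟨⟨hP0, hPX⟩, hPL⟩ := hPs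
  rw [Set.mem_iInter] at hPL
  set Q := policyOp Rx Ru A B (gain Ru A B P) P with hQ
  have hPQ : P ≤ Q := hPL _
  have hQs : Q ∈ s := by
    refine ⟨⟨hP0.trans hPQ, ?_⟩, Set.mem_iInter.mpr fun L => ?_⟩
    · exact (policyOp_gain_le hRu hP0 K).trans ((policyOp_mono K hPX).trans hX)
    · exact (policyOp_gain_le hRu hP0 L).trans (policyOp_mono L hPQ)
  have htr : Q.trace ≤ P.trace := hmax hQs
  have hzero : Q - P = 0 := by
    refine (Matrix.le_iff.mp hPQ).trace_eq_zero_iff.mp ?_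
    rw [Matrix.trace_sub]
    linarith [trace_le_trace hPQ]
  exact ⟨P, (isDARESolution_iff hRu).mpr ⟨hP0, sub_eq_zero.mp hzero⟩⟩

theorem existsUnique_isDARESolution (hRx : 1 ≤ Rx) (hRu : 1 ≤ Ru)
    {X : Matrix (Fin n) (Fin n) ℝ} (hX0 : 0 ≤ X) {K : Matrix (Fin m) (Fin n) ℝ}
    (hX : policyOp Rx Ru A B K X ≤ X) : ∃! P, IsDARESolution Rx Ru A B P := by
  obtain ⟨P, hP⟩ := exists_isDARESolution hRx hRu hX0 hX
  exact ⟨P, hP, fun Q hQ => hQ.unique hRx hRu hP⟩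

theorem isStabilizable_of_policyOp_le (hRx : 1 ≤ Rx) (hRu : 1 ≤ Ru)
    {X : Matrix (Fin n) (Fin n) ℝ} (hX0 : 0 ≤ X) {K : Matrix (Fin m) (Fin n) ℝ}
    (hX : policyOp Rx Ru A B K X ≤ X) : IsStabilizable A B :=
  ⟨K, isStable_of_lyapunov (one_le_stageCost hRx hRu K) hX0 hX⟩

theorem IsStabilizable.existsUnique_isDARESolution (hRx : 1 ≤ Rx) (hRu : 1 ≤ Ru)
    (h : IsStabilizable A B) : ∃! P, IsDARESolution Rx Ru A B P := by
  obtain ⟨K, hK⟩ := h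
  obtain ⟨X, hX0, hX⟩ := exists_lyapunov_of_isStable hK (one_le_stageCost hRx hRu K)
  exact LQR.existsUnique_isDARESolution hRx hRu hX0 hX

theorem isDARESolution_PInf (h : ∃ P, IsDARESolution Rx Ru A B P) :
    IsDARESolution Rx Ru A B (PInf Rx Ru A B) := by
  rw [PInf, dif_pos h]
  exact h.choose_spec

end riccati

/-! ### Weighted estimates and perturbation of the Riccati solution -/

section perturbation
open scoped MatrixOrder

variable {l m n : ℕ}

section sqrt

variable {X : Matrix (Fin n) (Fin n) ℝ}

theorem psdSqrt_mul_psdSqrt (hX : 0 ≤ X) : psdSqrt X * psdSqrt X = X :=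
  (psdSqrt_spec (Matrix.nonneg_iff_posSemidef.mp hX)).2

theorem psdSqrt_transpose (hX : 0 ≤ X) : (psdSqrt X)ᵀ = psdSqrt X :=
  transpose_eq_of_nonneg (Matrix.nonneg_iff_posSemidef.mpr
    (psdSqrt_spec (Matrix.nonneg_iff_posSemidef.mp hX)).1)

theorem isUnit_det_psdSqrt (hX : 1 ≤ X) : IsUnit (psdSqrt X).det := by
  have h := isUnit_det_of_one_le hX
  rw [← psdSqrt_mul_psdSqrt (one_nonneg_matrix.trans hX), Matrix.det_mul] at h
  exact isUnit_of_mul_isUnit_left h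

theorem inv_psdSqrt_transpose (hX : 0 ≤ X) : ((psdSqrt X)⁻¹)ᵀ = (psdSqrt X)⁻¹ := by
  rw [Matrix.transpose_nonsing_inv, psdSqrt_transpose hX]

theorem transpose_mul_self_psdSqrt_mul (hX : 0 ≤ X) (Y : Matrix (Fin n) (Fin l) ℝ) :
    (psdSqrt X * Y)ᵀ * (psdSqrt X * Y) = Yᵀ * X * Y := by
  conv_rhs => rw [← psdSqrt_mul_psdSqrt hX]
  rw [Matrix.transpose_mul, psdSqrt_transpose hX]
  simp only [Matrix.mul_assoc]

theorem opNorm_mul_inv_psdSqrt_le (hX : 1 ≤ X) {V : Matrix (Fin l) (Fin n) ℝ} {c : ℝ} (hc : 0 ≤ c)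
    (h : Vᵀ * V ≤ c ^ 2 • X) : opNorm (V * (psdSqrt X)⁻¹) ≤ c := by
  have hX0 := one_nonneg_matrix.trans hX
  have hu := isUnit_det_psdSqrt hX
  refine opNorm_le_of_transpose_mul_self_le hc ?_
  have h1 := conj_le_conj h (psdSqrt X)⁻¹
  refine le_trans (le_of_eq ?_) (h1.trans_eq ?_)
  · rw [Matrix.transpose_mul]; simp only [Matrix.mul_assoc]
  · rw [Matrix.mul_smul, Matrix.smul_mul, inv_psdSqrt_transpose hX0]
    congr 1
    calc (psdSqrt X)⁻¹ * X * (psdSqrt X)⁻¹ =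
          (psdSqrt X)⁻¹ * (psdSqrt X * psdSqrt X) * (psdSqrt X)⁻¹ := by
          rw [psdSqrt_mul_psdSqrt hX0]
      _ = 1 := by
          rw [Matrix.nonsing_inv_mul_cancel_left _ _ hu, Matrix.mul_nonsing_inv _ hu]

theorem opNorm_inv_psdSqrt_le (hX : 1 ≤ X) : opNorm (psdSqrt X)⁻¹ ≤ 1 := by
  have := opNorm_mul_inv_psdSqrt_le (V := 1) hX zero_le_one
    (by rwa [Matrix.transpose_one, Matrix.one_mul, one_pow, one_smul])
  rwa [Matrix.one_mul] at this

theorem opNorm_psdSqrt_mul_le (hX : 0 ≤ X) {Y : Matrix (Fin n) (Fin l) ℝ} {c : ℝ} (hc : 0 ≤ c)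
    (h : Yᵀ * X * Y ≤ c ^ 2 • 1) : opNorm (psdSqrt X * Y) ≤ c :=
  opNorm_le_of_transpose_mul_self_le hc (by rwa [transpose_mul_self_psdSqrt_mul hX])

theorem opNorm_psdSqrt_le (hX : 0 ≤ X) {s : ℝ} (hs : 0 ≤ s) (h : opNorm X ≤ s ^ 2) :
    opNorm (psdSqrt X) ≤ s := by
  have := opNorm_psdSqrt_mul_le (Y := 1) hX hs (by
    rw [Matrix.transpose_one, Matrix.one_mul, Matrix.mul_one]
    exact (le_opNorm_smul_one (transpose_eq_of_nonneg hX)).trans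
      (smul_le_smul_matrix_right one_nonneg_matrix h))
  rwa [Matrix.mul_one] at this

end sqrt

variable {Rx : Matrix (Fin n) (Fin n) ℝ} {Ru : Matrix (Fin m) (Fin m) ℝ}

section solution

variable {A : Matrix (Fin n) (Fin n) ℝ} {B : Matrix (Fin n) (Fin m) ℝ}
  {P : Matrix (Fin n) (Fin n) ℝ} {s : ℝ}

theorem IsDARESolution.nonneg (hRu : 1 ≤ Ru) (h : IsDARESolution Rx Ru A B P) : 0 ≤ P :=
  ((isDARESolution_iff hRu).mp h).1

theorem IsDARESolution.lyapunov (hRu : 1 ≤ Ru) (h : IsDARESolution Rx Ru A B P) :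
    (A + B * gain Ru A B P)ᵀ * P * (A + B * gain Ru A B P) +
      (Rx + (gain Ru A B P)ᵀ * Ru * gain Ru A B P) = P :=
  ((isDARESolution_iff hRu).mp h).2

theorem IsDARESolution.cross (hRu : 1 ≤ Ru) (h : IsDARESolution Rx Ru A B P)
    (K : Matrix (Fin m) (Fin n) ℝ) :
    (A + B * K)ᵀ * P * (A + B * gain Ru A B P) + (Rx + Kᵀ * Ru * gain Ru A B P) = P := by
  rw [policyOp_eq_cross hRu (h.nonneg hRu), ← policyOp_gain hRu (h.nonneg hRu)]
  exact h.lyapunov hRu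

theorem IsDARESolution.conj_nonneg (hRu : 1 ≤ Ru) (h : IsDARESolution Rx Ru A B P) :
    0 ≤ (A + B * gain Ru A B P)ᵀ * P * (A + B * gain Ru A B P) := by
  simpa using conj_le_conj (h.nonneg hRu) (A + B * gain Ru A B P)

theorem IsDARESolution.stageCost_le (hRu : 1 ≤ Ru) (h : IsDARESolution Rx Ru A B P) :
    Rx + (gain Ru A B P)ᵀ * Ru * gain Ru A B P ≤ P := by
  conv_rhs => rw [← h.lyapunov hRu]
  exact le_add_of_nonneg_left (h.conj_nonneg hRu)

theorem IsDARESolution.one_le (hRx : 1 ≤ Rx) (hRu : 1 ≤ Ru) (h : IsDARESolution Rx Ru A B P) :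
    1 ≤ P :=
  (one_le_stageCost hRx hRu _).trans (h.stageCost_le hRu)

theorem le_sq_smul_one (hP : 0 ≤ P) (hs : opNorm P = s ^ 2) : P ≤ s ^ 2 • 1 := by
  rw [← hs]; exact le_opNorm_smul_one (transpose_eq_of_nonneg hP)

/-- From `1 + Gᵀ * G ≤ P ≤ s²` one gets `‖G‖ ≤ √(s² - 1)`, and `1 + √(s² - 1) ≤ √2 s`. The sum `1 +
‖G‖` is the factor by which system errors enter the closed loop. -/
theorem IsDARESolution.opNorm_gain_le (hRx : 1 ≤ Rx) (hRu : 1 ≤ Ru)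
    (h : IsDARESolution Rx Ru A B P) (hs1 : 1 ≤ s) (hs : opNorm P = s ^ 2) :
    1 + opNorm (gain Ru A B P) ≤ 3 / 2 * s := by
  set G := gain Ru A B P
  have h1 : Gᵀ * G ≤ Gᵀ * Ru * G := by simpa using conj_le_conj hRu G
  have h2 : 1 + Gᵀ * G ≤ s ^ 2 • 1 :=
    (add_le_add hRx h1).trans ((h.stageCost_le hRu).trans (le_sq_smul_one (h.nonneg hRu) hs))
  have h3 : opNorm G ≤ Real.sqrt (s ^ 2 - 1) := by
    refine opNorm_le_of_transpose_mul_self_le (Real.sqrt_nonneg _) ?_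
    rw [Real.sq_sqrt (by nlinarith), sub_smul, one_smul, le_sub_iff_add_le, add_comm]
    exact h2
  have h4 : Real.sqrt (s ^ 2 - 1) ^ 2 = s ^ 2 - 1 := Real.sq_sqrt (by nlinarith)
  have h5 : 1 + Real.sqrt (s ^ 2 - 1) ≤ 3 / 2 * s := by
    refine le_of_sq_le_sq ?_ (by linarith)
    nlinarith [sq_nonneg (Real.sqrt (s ^ 2 - 1) - 1)]
  linarith

theorem IsDARESolution.opNorm_sqrt_mul_closedLoop_le (hRx : 1 ≤ Rx) (hRu : 1 ≤ Ru)
    (h : IsDARESolution Rx Ru A B P) (hs1 : 1 ≤ s) (hs : opNorm P = s ^ 2) :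
    opNorm (psdSqrt P * (A + B * gain Ru A B P)) ≤ s := by
  have hP := h.nonneg hRu
  refine opNorm_psdSqrt_mul_le hP (by linarith) (le_trans ?_ (le_sq_smul_one hP hs))
  conv_rhs => rw [← h.lyapunov hRu]
  exact le_add_of_nonneg_right (one_nonneg_matrix.trans (one_le_stageCost hRx hRu _))

/-- The stage cost is at least `1 ≥ P / s²`, so the Lyapunov equation gives `Mᵀ * P * M ≤ (1 - 1/s²)
• P`. -/
theorem IsDARESolution.opNorm_conj_closedLoop_le (hRx : 1 ≤ Rx) (hRu : 1 ≤ Ru)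
    (h : IsDARESolution Rx Ru A B P) (hs1 : 1 ≤ s) (hs : opNorm P = s ^ 2) :
    opNorm (psdSqrt P * (A + B * gain Ru A B P) * (psdSqrt P)⁻¹) ≤ Real.sqrt (1 - 1 / s ^ 2) := by
  have hP := h.nonneg hRu
  have hs0 : (0 : ℝ) < s ^ 2 := by positivity
  refine opNorm_mul_inv_psdSqrt_le (h.one_le hRx hRu) (Real.sqrt_nonneg _) ?_
  have h1 : 1 / s ^ 2 ≤ 1 := by rw [div_le_one hs0]; nlinarith
  rw [Real.sq_sqrt (by linarith), transpose_mul_self_psdSqrt_mul hP, sub_smul, one_smul,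
    le_sub_iff_add_le]
  conv_rhs => rw [← h.lyapunov hRu]
  refine add_le_add le_rfl (le_trans ?_ (one_le_stageCost hRx hRu _))
  have h2 := smul_le_smul_matrix (le_sq_smul_one hP hs) (show 0 ≤ 1 / s ^ 2 by positivity)
  rwa [smul_smul, one_div_mul_cancel hs0.ne', one_smul] at h2

end solution

variable {A A' : Matrix (Fin n) (Fin n) ℝ} {B B' : Matrix (Fin n) (Fin m) ℝ}

theorem matNorm_sub_A_le (c : NormKind) (A A' : Matrix (Fin n) (Fin n) ℝ)
    (B B' : Matrix (Fin n) (Fin m) ℝ) : matNorm c (A' - A) ≤ sysDist c A B A' B' := by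
  rw [← neg_sub, matNorm_neg]; exact le_max_left _ _

theorem matNorm_sub_B_le (c : NormKind) (A A' : Matrix (Fin n) (Fin n) ℝ)
    (B B' : Matrix (Fin n) (Fin m) ℝ) : matNorm c (B' - B) ≤ sysDist c A B A' B' := by
  rw [← neg_sub, matNorm_neg]; exact le_max_right _ _

theorem sysDist_nonneg (c : NormKind) (A A' : Matrix (Fin n) (Fin n) ℝ)
    (B B' : Matrix (Fin n) (Fin m) ℝ) : 0 ≤ sysDist c A B A' B' :=
  (matNorm_nonneg c _).trans (le_max_left _ _)

theorem matNorm_closedLoop_sub_le (c : NormKind) {K : Matrix (Fin m) (Fin n) ℝ} {s : ℝ}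
    (hK : 1 + opNorm K ≤ 3 / 2 * s) :
    matNorm c ((A' - A) + (B' - B) * K) ≤ 3 / 2 * s * sysDist c A B A' B' := by
  have h1 := matNorm_sub_A_le c A A' B B'
  have h2 := matNorm_sub_B_le c A A' B B'
  have h3 := matNorm_mul_le_right c (B' - B) K
  have h4 := matNorm_add_le c (A' - A) ((B' - B) * K)
  have h5 := mul_le_mul_of_nonneg_right h2 (opNorm_nonneg K)
  have h6 := mul_le_mul_of_nonneg_right hK (sysDist_nonneg c A A' B B')
  linarith

/-- The optimal feedback of the nominal system certifies a scaled value function for nearby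
systems. -/
theorem IsDARESolution.policyOp_perturbed_le (hRx : 1 ≤ Rx) (hRu : 1 ≤ Ru)
    {P : Matrix (Fin n) (Fin n) ℝ} (h : IsDARESolution Rx Ru A B P) {s : ℝ} (hs1 : 1 ≤ s)
    (hs : opNorm P = s ^ 2) {α : ℝ} (hα : α = 8 * s ^ 4 * sysDist .op A B A' B') (hα1 : α < 1) :
    policyOp Rx Ru A' B' (gain Ru A B P) ((1 - α / 2)⁻¹ • P) ≤ (1 - α / 2)⁻¹ • P := by
  have hP := h.nonneg hRu
  have hPT := transpose_eq_of_nonneg hP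
  have hLn := opNorm_psdSqrt_le hP (by linarith) hs.le
  have hLM := h.opNorm_sqrt_mul_closedLoop_le hRx hRu hs1 hs
  have hG := h.opNorm_gain_le hRx hRu hs1 hs
  have hly := h.lyapunov hRu
  have hS1 := one_le_stageCost hRx hRu (gain Ru A B P)
  have hD : opNorm _ ≤ _ := matNorm_closedLoop_sub_le (A := A) (A' := A') (B := B) (B' := B') .op hG
  set e := sysDist .op A B A' B'
  have he : 0 ≤ e := sysDist_nonneg .op A A' B B'
  set G := gain Ru A B P
  set M := A + B * G with hM
  set D := (A' - A) + (B' - B) * G with hDdef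
  set S := Rx + Gᵀ * Ru * G with hS
  set L := psdSqrt P
  have hLL : L * L = P := psdSqrt_mul_psdSqrt hP
  have hLT : Lᵀ = L := psdSqrt_transpose hP
  have hMD : A' + B' * G = M + D := by
    rw [hM, hDdef, Matrix.sub_mul]; abel
  set H := Mᵀ * P * D + (Mᵀ * P * D)ᵀ + Dᵀ * P * D with hH
  have hexp : (M + D)ᵀ * P * (M + D) = Mᵀ * P * M + H := by
    simp only [hH, Matrix.transpose_add, Matrix.transpose_mul, Matrix.transpose_transpose, hPT,
      Matrix.mul_add, Matrix.add_mul, Matrix.mul_assoc]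
    abel
  have hHT : Hᵀ = H := by
    simp only [hH, Matrix.transpose_add, Matrix.transpose_mul, Matrix.transpose_transpose, hPT,
      Matrix.mul_assoc]
    abel
  have hLD : opNorm (L * D) ≤ s * (3 / 2 * s * e) :=
    (opNorm_mul_le L D).trans (mul_le_mul hLn hD (opNorm_nonneg _) (by linarith))
  have hc1 : opNorm (Mᵀ * P * D) ≤ s * (s * (3 / 2 * s * e)) := by
    have : Mᵀ * P * D = (L * M)ᵀ * (L * D) := by
      rw [← hLL, Matrix.transpose_mul, hLT]; simp only [Matrix.mul_assoc]
    rw [this]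
    refine (opNorm_mul_le _ _).trans (mul_le_mul ?_ hLD (opNorm_nonneg _) (by linarith))
    rw [opNorm_transpose]; exact hLM
  have hc2 : opNorm (Dᵀ * P * D) ≤ s * (3 / 2 * s * e) * (s * (3 / 2 * s * e)) := by
    rw [← transpose_mul_self_psdSqrt_mul hP]
    refine (opNorm_mul_le _ _).trans (mul_le_mul ?_ hLD (opNorm_nonneg _) (by positivity))
    rw [opNorm_transpose]; exact hLD
  -- The linear terms contribute `3 s³ ε` and the quadratic one `(9/4) s⁴ ε²`. Since `α < 1` forces
  -- `ε ≤ 1/8`, the total is at most `(3 + 9/32) s⁴ ε ≤ 4 s⁴ ε`.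
  have hHn : opNorm H ≤ α / 2 := by
    have h1 := opNorm_add_le (Mᵀ * P * D + (Mᵀ * P * D)ᵀ) (Dᵀ * P * D)
    have h2 := opNorm_add_le (Mᵀ * P * D) (Mᵀ * P * D)ᵀ
    rw [opNorm_transpose] at h2
    have hs34 : s ^ 3 * e ≤ s ^ 4 * e :=
      mul_le_mul_of_nonneg_right (pow_le_pow_right₀ hs1 (by norm_num)) he
    have hs4 : e ≤ s ^ 4 * e := le_mul_of_one_le_left he (one_le_pow₀ hs1)
    have he8 : e ≤ 1 / 8 := by linarith
    have hq : s ^ 4 * e * e ≤ s ^ 4 * e * (1 / 8) :=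
      mul_le_mul_of_nonneg_left he8 (by positivity)
    have hnn : 0 ≤ s ^ 4 * e := by positivity
    rw [hα]
    calc opNorm H ≤ 3 * (s ^ 3 * e) + 9 / 4 * (s ^ 4 * e * e) := by linarith
      _ ≤ 8 * s ^ 4 * e / 2 := by linarith
  have hα0 : 0 ≤ α := by rw [hα]; positivity
  -- The perturbation is absorbed by a fraction of the stage cost, which is at least 1.
  have hHS : H ≤ (α / 2) • S :=
    (le_opNorm_smul_one hHT).trans ((smul_le_smul_matrix_right one_nonneg_matrix hHn).trans
      (smul_le_smul_matrix hS1 (by linarith)))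
  have hβ : 0 < 1 - α / 2 := by linarith
  have hmain : (M + D)ᵀ * P * (M + D) + (1 - α / 2) • S ≤ P := by
    rw [hexp, sub_smul, one_smul]
    calc Mᵀ * P * M + H + (S - (α / 2) • S) ≤
          Mᵀ * P * M + (α / 2) • S + (S - (α / 2) • S) :=
          add_le_add (add_le_add le_rfl hHS) le_rfl
      _ = Mᵀ * P * M + S := by abel
      _ = P := hly
  have := smul_le_smul_matrix hmain (inv_nonneg.mpr hβ.le)
  rw [smul_add, smul_smul, inv_mul_cancel₀ hβ.ne', one_smul] at this
  rw [policyOp, hMD, Matrix.mul_smul, Matrix.smul_mul]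
  exact this

section difference

variable {P P' : Matrix (Fin n) (Fin n) ℝ}

/-- The exact perturbation identity for Riccati solutions. -/
theorem IsDARESolution.sub_eq (hRu : 1 ≤ Ru) (h : IsDARESolution Rx Ru A B P)
    (h' : IsDARESolution Rx Ru A' B' P') :
    P' - P = (A' + B' * gain Ru A' B' P')ᵀ * (P' - P) * (A + B * gain Ru A B P) +
      (A' + B' * gain Ru A' B' P')ᵀ * P' * ((A' - A) + (B' - B) * gain Ru A B P) +
      ((A' - A) + (B' - B) * gain Ru A' B' P')ᵀ * P * (A + B * gain Ru A B P) := by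
  -- Each equation is written with the other system's feedback on one side; both then contain the
  -- same cost term `Rx + G'ᵀ * Ru * G`, which cancels in the difference.
  have h1 := h.cross hRu (gain Ru A' B' P')
  have h2 := congrArg Matrix.transpose (h'.cross hRu (gain Ru A B P))
  have hPT' := transpose_eq_of_nonneg (h'.nonneg hRu)
  have hRuT := transpose_eq_of_one_le hRu
  -- Symmetry of `Rx` is read off from the Lyapunov equation, whose other terms are symmetric.
  have hRxT : Rxᵀ = Rx := by
    have := congrArg Matrix.transpose (h.lyapunov hRu)
    have h3 := h.lyapunov hRu
    rw [transpose_eq_of_nonneg (h.nonneg hRu)] at this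
    conv_rhs at this => rw [← h3]
    simpa [Matrix.transpose_mul, hRuT, transpose_eq_of_nonneg (h.nonneg hRu),
      Matrix.mul_assoc] using this
  generalize gain Ru A B P = G at *
  generalize gain Ru A' B' P' = G' at *
  conv_lhs => rw [← h1, ← hPT', ← h2]
  simp only [Matrix.transpose_add, Matrix.transpose_mul, Matrix.transpose_sub,
    Matrix.transpose_transpose, hPT', hRuT, hRxT, Matrix.mul_add, Matrix.add_mul, Matrix.mul_sub,
    Matrix.sub_mul, Matrix.mul_assoc]
  abel

/-- With `x = 1/s` and `y = 1/t`: `(1 - x²)(1 - y²) ≤ (1 - x y)²`, which amounts to `(x - y)² ≥ 0`.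
-/
theorem sqrt_mul_sqrt_le {s t : ℝ} (hs : 1 ≤ s) (ht : 1 ≤ t) :
    Real.sqrt (1 - 1 / s ^ 2) * Real.sqrt (1 - 1 / t ^ 2) ≤ 1 - 1 / (s * t) := by
  have hs1 : 1 / s ≤ 1 := by rw [div_le_one (by linarith)]; exact hs
  have ht1 : 1 / t ≤ 1 := by rw [div_le_one (by linarith)]; exact ht
  have hs0 : 0 ≤ 1 / s := by positivity
  have ht0 : 0 ≤ 1 / t := by positivity
  have e1 : 1 / s ^ 2 = (1 / s) ^ 2 := by ring
  have e2 : 1 / t ^ 2 = (1 / t) ^ 2 := by ring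
  have e3 : 1 / (s * t) = (1 / s) * (1 / t) := by rw [one_div_mul_one_div]
  rw [e1, e2, e3]
  generalize 1 / s = x at *
  generalize 1 / t = y at *
  have hx : 0 ≤ 1 - x ^ 2 := by nlinarith
  have hy : 0 ≤ 1 - y ^ 2 := by nlinarith
  rw [← Real.sqrt_mul hx]
  refine Real.sqrt_le_iff.mpr ⟨by nlinarith, by nlinarith [sq_nonneg (x - y)]⟩

/-- The weighted difference of two Riccati solutions is Lipschitz in the system. -/
theorem IsDARESolution.matNorm_weighted_sub_le (hRx : 1 ≤ Rx) (hRu : 1 ≤ Ru)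
    (h : IsDARESolution Rx Ru A B P) (h' : IsDARESolution Rx Ru A' B' P') {s t : ℝ}
    (hs1 : 1 ≤ s) (ht1 : 1 ≤ t) (hs : opNorm P = s ^ 2) (ht : opNorm P' = t ^ 2) (c : NormKind) :
    matNorm c ((psdSqrt P')⁻¹ * (P' - P) * (psdSqrt P)⁻¹) ≤
      3 * s ^ 2 * t ^ 2 * sysDist c A B A' B' := by
  have hP := h.nonneg hRu
  have hP' := h'.nonneg hRu
  have hid := h.sub_eq hRu h'
  have hD := matNorm_closedLoop_sub_le (A := A) (A' := A') (B := B) (B' := B') c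
    (h.opNorm_gain_le hRx hRu hs1 hs)
  have hD' := matNorm_closedLoop_sub_le (A := A) (A' := A') (B := B) (B' := B') c
    (h'.opNorm_gain_le hRx hRu ht1 ht)
  have hN := h.opNorm_conj_closedLoop_le hRx hRu hs1 hs
  have hN' := h'.opNorm_conj_closedLoop_le hRx hRu ht1 ht
  have hLn := opNorm_psdSqrt_le hP (by linarith) hs.le
  have hLn' := opNorm_psdSqrt_le hP' (by linarith) ht.le
  have hLi := opNorm_inv_psdSqrt_le (h.one_le hRx hRu)
  have hLi' := opNorm_inv_psdSqrt_le (h'.one_le hRx hRu)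
  have hu := isUnit_det_psdSqrt (h.one_le hRx hRu)
  have hu' := isUnit_det_psdSqrt (h'.one_le hRx hRu)
  have hLL := psdSqrt_mul_psdSqrt hP
  have hLL' := psdSqrt_mul_psdSqrt hP'
  have hLT' := psdSqrt_transpose hP'
  have hLiT' := inv_psdSqrt_transpose hP'
  set e := sysDist c A B A' B'
  have he : 0 ≤ e := sysDist_nonneg c A A' B B'
  set D := (A' - A) + (B' - B) * gain Ru A B P
  set D' := (A' - A) + (B' - B) * gain Ru A' B' P'
  set M := A + B * gain Ru A B P
  set M' := A' + B' * gain Ru A' B' P'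
  set L := psdSqrt P
  set L' := psdSqrt P'
  set N := L * M * L⁻¹ with hNdef
  set N' := L' * M' * L'⁻¹ with hNdef'
  set Z := L'⁻¹ * (P' - P) * L⁻¹ with hZ
  have hΔ : P' - P = L' * Z * L := by
    rw [hZ, Matrix.mul_assoc L'⁻¹, Matrix.mul_nonsing_inv_cancel_left _ _ hu',
      Matrix.nonsing_inv_mul_cancel_right _ _ hu]
  have hNT' : N'ᵀ = L'⁻¹ * M'ᵀ * L' := by
    rw [hNdef', Matrix.transpose_mul, Matrix.transpose_mul, hLT', hLiT', Matrix.mul_assoc]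
  have hZeq : Z = N'ᵀ * (Z * N) + N'ᵀ * (L' * D * L⁻¹) + (L'⁻¹ * D'ᵀ * L) * N := by
    conv_lhs => rw [hZ, hid, hΔ]
    rw [hNT', hNdef, ← hLL]
    conv_lhs => rw [← hLL']
    simp only [Matrix.mul_add, Matrix.add_mul, Matrix.mul_assoc]
  have z0 := matNorm_nonneg c Z
  have hr0 := Real.sqrt_nonneg (1 - 1 / s ^ 2)
  have hr0' := Real.sqrt_nonneg (1 - 1 / t ^ 2)
  have hr1 : Real.sqrt (1 - 1 / s ^ 2) ≤ 1 := by
    refine Real.sqrt_le_one.mpr ?_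
    have : 0 ≤ 1 / s ^ 2 := by positivity
    linarith
  have hr1' : Real.sqrt (1 - 1 / t ^ 2) ≤ 1 := by
    refine Real.sqrt_le_one.mpr ?_
    have : 0 ≤ 1 / t ^ 2 := by positivity
    linarith
  have hrr := sqrt_mul_sqrt_le hs1 ht1
  have b1 : matNorm c (N'ᵀ * (Z * N)) ≤ (1 - 1 / (s * t)) * matNorm c Z := by
    refine (matNorm_mul_le_left c _ _).trans ?_
    rw [opNorm_transpose]
    calc opNorm N' * matNorm c (Z * N) ≤ opNorm N' * (matNorm c Z * opNorm N) :=
          mul_le_mul_of_nonneg_left (matNorm_mul_le_right c _ _) (opNorm_nonneg _)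
      _ = opNorm N * opNorm N' * matNorm c Z := by ring
      _ ≤ (1 - 1 / (s * t)) * matNorm c Z :=
          mul_le_mul_of_nonneg_right
            ((mul_le_mul hN hN' (opNorm_nonneg _) hr0).trans hrr) z0
  have b2 : matNorm c (N'ᵀ * (L' * D * L⁻¹)) ≤ 1 * (t * (3 / 2 * s * e) * 1) := by
    refine (matNorm_mul_le_left c _ _).trans (mul_le_mul ?_ ?_ (matNorm_nonneg _ _) zero_le_one)
    · rw [opNorm_transpose]; exact hN'.trans hr1'
    · refine (matNorm_mul_le_right c _ _).trans
        (mul_le_mul ?_ hLi (opNorm_nonneg _) (by positivity))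
      exact (matNorm_mul_le_left c _ _).trans
        (mul_le_mul hLn' hD (matNorm_nonneg _ _) (by linarith))
  have b3 : matNorm c ((L'⁻¹ * D'ᵀ * L) * N) ≤ 1 * (3 / 2 * t * e) * s * 1 := by
    refine (matNorm_mul_le_right c _ _).trans
      (mul_le_mul ?_ (hN.trans hr1) (opNorm_nonneg _) (by positivity))
    refine (matNorm_mul_le_right c _ _).trans
      (mul_le_mul ?_ hLn (opNorm_nonneg _) (by positivity))
    refine (matNorm_mul_le_left c _ _).trans
      (mul_le_mul hLi' ?_ (matNorm_nonneg _ _) zero_le_one)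
    rw [matNorm_transpose]; exact hD'
  have hst : 0 < s * t := by positivity
  -- The homogeneous term is absorbed on the left; each of the two error terms contributes `(3/2) s
  -- t ε`.
  have hfin : 1 / (s * t) * matNorm c Z ≤ 3 * (s * t) * e := by
    have t1 := matNorm_add_le c (N'ᵀ * (Z * N) + N'ᵀ * (L' * D * L⁻¹)) ((L'⁻¹ * D'ᵀ * L) * N)
    have t2 := matNorm_add_le c (N'ᵀ * (Z * N)) (N'ᵀ * (L' * D * L⁻¹))
    rw [← hZeq] at t1
    linarith
  rw [one_div, inv_mul_le_iff₀ hst] at hfin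
  linarith

/-- Substitute `Ru * G = -(Bᵀ * P * M)` for the nominal system and `R' * G' = -(B'ᵀ * P' * A')` for
the perturbed one. -/
theorem inputWeight_mul_gain_sub (hRu : 1 ≤ Ru) (hP : 0 ≤ P) (hP' : 0 ≤ P') :
    (Ru + B'ᵀ * P' * B') * (gain Ru A' B' P' - gain Ru A B P) =
      -(B'ᵀ * P' * ((A' - A) + (B' - B) * gain Ru A B P) +
        B'ᵀ * (P' - P) * (A + B * gain Ru A B P) +
        (B' - B)ᵀ * P * (A + B * gain Ru A B P)) := by
  have h1 := gain_stationary (A := A) (B := B) hRu hP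
  have h2 := inputWeight_mul_gain (A := A') (B := B') hRu hP'
  rw [Matrix.mul_sub, h2, Matrix.add_mul, eq_neg_of_add_eq_zero_right h1]
  simp only [Matrix.transpose_sub, Matrix.mul_add, Matrix.mul_sub,
    Matrix.sub_mul, Matrix.mul_assoc]
  abel

/-- The weighted difference of the optimal feedbacks is Lipschitz in the system. -/
theorem IsDARESolution.matNorm_weighted_gain_sub_le (hRx : 1 ≤ Rx) (hRu : 1 ≤ Ru)
    (h : IsDARESolution Rx Ru A B P) (h' : IsDARESolution Rx Ru A' B' P') {s t : ℝ}
    (hs1 : 1 ≤ s) (ht1 : 1 ≤ t) (hs : opNorm P = s ^ 2) (ht : opNorm P' = t ^ 2) (c : NormKind) :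
    matNorm c (psdSqrt (Ru + B'ᵀ * P' * B') * (gain Ru A' B' P' - gain Ru A B P)) ≤
      (3 / 2 * s * t + 3 * s ^ 3 * t ^ 2 + s ^ 2) * sysDist c A B A' B' := by
  have hP := h.nonneg hRu
  have hP' := h'.nonneg hRu
  have hR1 := one_le_inputWeight hRu hP' B'
  have hid := inputWeight_mul_gain_sub (A := A) (A' := A') (B := B) (B' := B') hRu hP hP'
  have hZn := h.matNorm_weighted_sub_le hRx hRu h' hs1 ht1 hs ht c
  have hD := matNorm_closedLoop_sub_le (A := A) (A' := A') (B := B) (B' := B') c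
    (h.opNorm_gain_le hRx hRu hs1 hs)
  have hB := matNorm_sub_B_le c A A' B B'
  have hLM := h.opNorm_sqrt_mul_closedLoop_le hRx hRu hs1 hs
  have hLn := opNorm_psdSqrt_le hP (by linarith) hs.le
  have hLn' := opNorm_psdSqrt_le hP' (by linarith) ht.le
  have hu := isUnit_det_psdSqrt (h.one_le hRx hRu)
  have hu' := isUnit_det_psdSqrt (h'.one_le hRx hRu)
  have hLL := psdSqrt_mul_psdSqrt hP
  have hLL' := psdSqrt_mul_psdSqrt hP'
  have hLT' := psdSqrt_transpose hP'
  have huT := isUnit_det_psdSqrt hR1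
  have hTT := psdSqrt_mul_psdSqrt (one_nonneg_matrix.trans hR1)
  have hTiT := inv_psdSqrt_transpose (one_nonneg_matrix.trans hR1)
  have hTi := opNorm_inv_psdSqrt_le hR1
  -- A contraction because `B'ᵀ * P' * B'` is dominated by the input weight.
  have hV : opNorm (psdSqrt P' * B' * (psdSqrt (Ru + B'ᵀ * P' * B'))⁻¹) ≤ 1 := by
    refine opNorm_mul_inv_psdSqrt_le hR1 zero_le_one ?_
    rw [transpose_mul_self_psdSqrt_mul hP', one_pow, one_smul]
    exact le_add_of_nonneg_left (one_nonneg_matrix.trans hRu)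
  set e := sysDist c A B A' B'
  have he : 0 ≤ e := sysDist_nonneg c A A' B B'
  set E := gain Ru A' B' P' - gain Ru A B P
  set D := (A' - A) + (B' - B) * gain Ru A B P
  set M := A + B * gain Ru A B P
  set L := psdSqrt P
  set L' := psdSqrt P'
  set R := Ru + B'ᵀ * P' * B'
  set T := psdSqrt R
  set Z := L'⁻¹ * (P' - P) * L⁻¹ with hZ
  set V := L' * B' * T⁻¹ with hVdef
  have hVT : Vᵀ = T⁻¹ * B'ᵀ * L' := by
    rw [hVdef, Matrix.transpose_mul, Matrix.transpose_mul, hLT', hTiT, Matrix.mul_assoc]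
  have hΔ : P' - P = L' * Z * L := by
    rw [hZ, Matrix.mul_assoc L'⁻¹, Matrix.mul_nonsing_inv_cancel_left _ _ hu',
      Matrix.nonsing_inv_mul_cancel_right _ _ hu]
  have hTE : T * E = -(Vᵀ * (L' * D) + Vᵀ * (Z * (L * M)) + T⁻¹ * (B' - B)ᵀ * L * (L * M)) := by
    have e1 : T * E = T⁻¹ * (R * E) := by
      rw [← hTT, Matrix.mul_assoc, Matrix.nonsing_inv_mul_cancel_left _ _ huT]
    rw [e1, hid, hΔ, hVT, ← hLL, Matrix.mul_neg]
    conv_lhs => rw [← hLL']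
    simp only [Matrix.mul_add, Matrix.mul_assoc]
  have b1 : matNorm c (Vᵀ * (L' * D)) ≤ 1 * (t * (3 / 2 * s * e)) := by
    refine (matNorm_mul_le_left c _ _).trans (mul_le_mul ?_ ?_ (matNorm_nonneg _ _) zero_le_one)
    · rw [opNorm_transpose]; exact hV
    · exact (matNorm_mul_le_left c _ _).trans
        (mul_le_mul hLn' hD (matNorm_nonneg _ _) (by linarith))
  have b2 : matNorm c (Vᵀ * (Z * (L * M))) ≤ 1 * (3 * s ^ 2 * t ^ 2 * e * s) := by
    refine (matNorm_mul_le_left c _ _).trans (mul_le_mul ?_ ?_ (matNorm_nonneg _ _) zero_le_one)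
    · rw [opNorm_transpose]; exact hV
    · exact (matNorm_mul_le_right c _ _).trans
        (mul_le_mul hZn hLM (opNorm_nonneg _) (by positivity))
  have b3 : matNorm c (T⁻¹ * (B' - B)ᵀ * L * (L * M)) ≤ 1 * e * s * s := by
    refine (matNorm_mul_le_right c _ _).trans
      (mul_le_mul ?_ hLM (opNorm_nonneg _) (by positivity))
    refine (matNorm_mul_le_right c _ _).trans
      (mul_le_mul ?_ hLn (opNorm_nonneg _) (by positivity))
    refine (matNorm_mul_le_left c _ _).trans
      (mul_le_mul hTi ?_ (matNorm_nonneg _ _) zero_le_one)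
    rw [matNorm_transpose]; exact hB
  have t1 := matNorm_add_le c (Vᵀ * (L' * D) + Vᵀ * (Z * (L * M))) (T⁻¹ * (B' - B)ᵀ * L * (L * M))
  have t2 := matNorm_add_le c (Vᵀ * (L' * D)) (Vᵀ * (Z * (L * M)))
  rw [hTE, matNorm_neg]
  linarith

end difference

end perturbation

/-! ### Bounds in terms of the nominal solution -/

section
open scoped MatrixOrder

variable {m n : ℕ} {Rx : Matrix (Fin n) (Fin n) ℝ} {Ru : Matrix (Fin m) (Fin m) ℝ}
  {A A' : Matrix (Fin n) (Fin n) ℝ} {B B' : Matrix (Fin n) (Fin m) ℝ}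
  {P P' : Matrix (Fin n) (Fin n) ℝ}

theorem one_le_opNorm [Nonempty (Fin n)] {X : Matrix (Fin n) (Fin n) ℝ} (h : 1 ≤ X) :
    1 ≤ opNorm X := by
  obtain ⟨i⟩ := ‹Nonempty (Fin n)›
  have h1 : 1 ≤ opNorm X • (1 : Matrix (Fin n) (Fin n) ℝ) :=
    h.trans (le_opNorm_smul_one (transpose_eq_of_one_le h))
  have h2 := (Matrix.le_iff.mp h1).diag_nonneg (i := i)
  simpa using h2

/-- A value function certifying a nearby system, in every state dimension. -/
theorem IsDARESolution.exists_policyOp_le (hRx : 1 ≤ Rx) (hRu : 1 ≤ Ru)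
    (h : IsDARESolution Rx Ru A B P) {α : ℝ}
    (hα : α = 8 * opNorm P ^ 2 * sysDist .op A B A' B') (hα1 : α < 1) :
    0 ≤ (1 - α / 2)⁻¹ • P ∧
      policyOp Rx Ru A' B' (gain Ru A B P) ((1 - α / 2)⁻¹ • P) ≤ (1 - α / 2)⁻¹ • P := by
  have hβ : (0 : ℝ) ≤ (1 - α / 2)⁻¹ := inv_nonneg.mpr (by linarith)
  refine ⟨by simpa using smul_le_smul_matrix (h.nonneg hRu) hβ, ?_⟩
  -- In dimension zero `‖P‖ = 0`, so `s = √‖P‖ ≥ 1` fails.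
  rcases isEmpty_or_nonempty (Fin n) with hn | hn
  · exact (Subsingleton.elim _ _).le
  have hp := one_le_opNorm (h.one_le hRx hRu)
  have hs : opNorm P = Real.sqrt (opNorm P) ^ 2 := (Real.sq_sqrt (opNorm_nonneg P)).symm
  refine h.policyOp_perturbed_le hRx hRu (Real.one_le_sqrt.mpr hp) hs ?_ hα1
  rw [hα]
  conv_lhs => rw [hs]
  ring

/-- Equivalent to `1 - α ≤ (1 - α / 2)²`. -/
theorem inv_one_sub_half_le {α : ℝ} (hα1 : α < 1) :
    (1 - α / 2)⁻¹ ≤ (1 - α) ^ (-(1 / 2) : ℝ) := by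
  have h1 : 0 < 1 - α := by linarith
  rw [Real.rpow_neg h1.le, ← Real.sqrt_eq_rpow]
  refine inv_anti₀ (Real.sqrt_pos.mpr h1) ?_
  refine Real.sqrt_le_iff.mpr ⟨by linarith, by nlinarith [sq_nonneg α]⟩

/-- Optimal values of a nearby system are bounded by those of the nominal one. -/
theorem IsDARESolution.opNorm_le (hRx : 1 ≤ Rx) (hRu : 1 ≤ Ru)
    (h : IsDARESolution Rx Ru A B P) (h' : IsDARESolution Rx Ru A' B' P') {α : ℝ}
    (hα : α = 8 * opNorm P ^ 2 * sysDist .op A B A' B') (hα1 : α < 1) :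
    opNorm P' ≤ (1 - α) ^ (-(1 / 2) : ℝ) * opNorm P := by
  obtain ⟨hX0, hX⟩ := h.exists_policyOp_le hRx hRu hα hα1
  refine opNorm_le_of_le_smul_one (h'.nonneg hRu)
    (mul_nonneg (Real.rpow_nonneg (by linarith) _) (opNorm_nonneg P)) ?_
  refine (h'.le_of_policyOp_le hRx hRu hX0 hX).trans ?_
  refine (smul_le_smul_matrix_right (h.nonneg hRu) (inv_one_sub_half_le hα1)).trans ?_
  rw [mul_smul]
  exact smul_le_smul_matrix (le_opNorm_smul_one (transpose_eq_of_nonneg (h.nonneg hRu)))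
    (Real.rpow_nonneg (by linarith) _)

/-- Perturbation bounds for the optimal feedback in terms of the square root `s` of `‖P‖` and
the fourth root `u` of `(1 - α)⁻¹`. -/
theorem IsDARESolution.matNorm_gain_sub_le (hRx : 1 ≤ Rx) (hRu : 1 ≤ Ru)
    (h : IsDARESolution Rx Ru A B P) (h' : IsDARESolution Rx Ru A' B' P') {s t u : ℝ}
    (hs1 : 1 ≤ s) (ht1 : 1 ≤ t) (hu1 : 1 ≤ u) (hs : opNorm P = s ^ 2) (ht : opNorm P' = t ^ 2)
    (htu : t ≤ u * s) (hε : sysDist .op A B A' B' ≤ 1 / 8) (c : NormKind) :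
    matNorm c (gain Ru A' B' P' - gain Ru A B P) ≤ 7 * u ^ 7 * s ^ 7 * sysDist c A B A' B' ∧
    matNorm c (psdSqrt Ru * (gain Ru A' B' P' - gain Ru A B P)) ≤
      7 * u ^ 7 * s ^ 7 * sysDist c A B A' B' ∧
    matNorm c (B * (gain Ru A' B' P' - gain Ru A B P)) ≤
      8 * u ^ 7 * s ^ 7 * sysDist c A B A' B' ∧
    matNorm c (psdSqrt P * B * (gain Ru A' B' P' - gain Ru A B P)) ≤
      9 * u ^ 7 * s ^ 7 * sysDist c A B A' B' := by
  have hP := h.nonneg hRu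
  have hP' := h'.nonneg hRu
  have hRu0 := one_nonneg_matrix.trans hRu
  have hR1 := one_le_inputWeight hRu hP' B'
  have hTE := h.matNorm_weighted_gain_sub_le hRx hRu h' hs1 ht1 hs ht c
  have huT := isUnit_det_psdSqrt hR1
  have hu' := isUnit_det_psdSqrt (h'.one_le hRx hRu)
  have hTi := opNorm_inv_psdSqrt_le hR1
  have hLi' := opNorm_inv_psdSqrt_le (h'.one_le hRx hRu)
  have hLn := opNorm_psdSqrt_le hP (by linarith) hs.le
  have hV : opNorm (psdSqrt P' * B' * (psdSqrt (Ru + B'ᵀ * P' * B'))⁻¹) ≤ 1 := by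
    refine opNorm_mul_inv_psdSqrt_le hR1 zero_le_one ?_
    rw [transpose_mul_self_psdSqrt_mul hP', one_pow, one_smul]
    exact le_add_of_nonneg_left hRu0
  have hW : opNorm (psdSqrt Ru * (psdSqrt (Ru + B'ᵀ * P' * B'))⁻¹) ≤ 1 := by
    refine opNorm_mul_inv_psdSqrt_le hR1 zero_le_one ?_
    rw [psdSqrt_transpose hRu0, psdSqrt_mul_psdSqrt hRu0, one_pow, one_smul]
    exact le_add_of_nonneg_right (by simpa using conj_le_conj hP' B')
  have hB : opNorm (B' - B) ≤ 1 / 8 := (matNorm_sub_B_le .op A A' B B').trans hε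
  set e := sysDist c A B A' B'
  have he : 0 ≤ e := sysDist_nonneg c A A' B B'
  set E := gain Ru A' B' P' - gain Ru A B P
  set T := psdSqrt (Ru + B'ᵀ * P' * B')
  set L' := psdSqrt P'
  have hTT : T⁻¹ * (T * E) = E := Matrix.nonsing_inv_mul_cancel_left _ _ huT
  set w := u ^ 2 * s ^ 5 * e with hw
  have hw0 : 0 ≤ w := by positivity
  have hus : 1 ≤ u ^ 2 := one_le_pow₀ hu1
  -- `11/2 = 3/2 + 3 + 1`: each of the three monomials is at most `u² s⁵`.
  have hwTE : matNorm c (T * E) ≤ 11 / 2 * w := by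
    have ht2 : t ^ 2 ≤ u ^ 2 * s ^ 2 := by
      rw [← mul_pow]; exact pow_le_pow_left₀ (by linarith) htu 2
    have hs25 : s ^ 2 ≤ s ^ 5 := pow_le_pow_right₀ hs1 (by norm_num)
    have c1 : s * t ≤ u ^ 2 * s ^ 5 :=
      calc s * t ≤ s * (u * s) := mul_le_mul_of_nonneg_left htu (by linarith)
        _ = u * s ^ 2 := by ring
        _ ≤ u ^ 2 * s ^ 5 := mul_le_mul (le_self_pow₀ hu1 two_ne_zero) hs25 (by positivity)
            (by positivity)
    have c2 : s ^ 3 * t ^ 2 ≤ u ^ 2 * s ^ 5 :=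
      calc s ^ 3 * t ^ 2 ≤ s ^ 3 * (u ^ 2 * s ^ 2) :=
            mul_le_mul_of_nonneg_left ht2 (by positivity)
        _ = u ^ 2 * s ^ 5 := by ring
    have c3 : s ^ 2 ≤ u ^ 2 * s ^ 5 :=
      hs25.trans (le_mul_of_one_le_left (by positivity) hus)
    have c4 : 3 / 2 * s * t + 3 * s ^ 3 * t ^ 2 + s ^ 2 ≤ 11 / 2 * (u ^ 2 * s ^ 5) := by linarith
    refine hTE.trans ((mul_le_mul_of_nonneg_right c4 he).trans_eq ?_)
    rw [hw]; ring
  have hle : ∀ {k : ℕ} {V : Matrix (Fin k) (Fin m) ℝ}, opNorm V ≤ 1 →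
      matNorm c (V * (T * E)) ≤ 11 / 2 * w := fun hV =>
    (matNorm_mul_le_left c _ _).trans
      ((mul_le_of_le_one_left (matNorm_nonneg c _) hV).trans hwTE)
  have hE : matNorm c E ≤ 11 / 2 * w := by
    have := hle hTi
    rwa [hTT] at this
  have hRE : matNorm c (psdSqrt Ru * E) ≤ 11 / 2 * w := by
    have := hle hW
    rwa [Matrix.mul_assoc, hTT] at this
  have hB'E : matNorm c (B' * E) ≤ 11 / 2 * w := by
    have h1 := hle hV
    rw [Matrix.mul_assoc, hTT, Matrix.mul_assoc] at h1
    have h2 : B' * E = L'⁻¹ * (L' * (B' * E)) :=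
      (Matrix.nonsing_inv_mul_cancel_left _ _ hu').symm
    rw [h2]
    exact (matNorm_mul_le_left c _ _).trans
      ((mul_le_of_le_one_left (matNorm_nonneg c _) hLi').trans h1)
  -- Passing from `B'` to `B` costs `‖B' - B‖ ≤ 1/8`, so the constant is `11/2 * (1 + 1/8)`.
  have hBE : matNorm c (B * E) ≤ 99 / 16 * w := by
    have h1 : B * E = B' * E + -((B' - B) * E) := by rw [Matrix.sub_mul]; abel
    have h2 := matNorm_add_le c (B' * E) (-((B' - B) * E))
    rw [matNorm_neg, ← h1] at h2
    have h3 := (matNorm_mul_le_left c (B' - B) E).trans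
      (mul_le_mul hB hE (matNorm_nonneg c _) (by norm_num))
    linarith
  have hPBE : matNorm c (psdSqrt P * B * E) ≤ s * (99 / 16 * w) := by
    rw [Matrix.mul_assoc]
    exact (matNorm_mul_le_left c _ _).trans
      (mul_le_mul hLn hBE (matNorm_nonneg c _) (by linarith))
  have hu27 : u ^ 2 ≤ u ^ 7 := pow_le_pow_right₀ hu1 (by norm_num)
  have hsw : s * w ≤ u ^ 7 * s ^ 7 * e := by
    have hs67 : s ^ 6 ≤ s ^ 7 := pow_le_pow_right₀ hs1 (by norm_num)
    calc s * w = u ^ 2 * s ^ 6 * e := by rw [hw]; ring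
      _ ≤ u ^ 7 * s ^ 7 * e := mul_le_mul_of_nonneg_right
          (mul_le_mul hu27 hs67 (by positivity) (by positivity)) he
  have hww : w ≤ s * w := le_mul_of_one_le_left hw0 hs1
  refine ⟨?_, ?_, ?_, ?_⟩ <;> linarith

end

end LQR

/-! ### Main theorem -/

open scoped MatrixOrder in
theorem mainTheorem4 {n m : ℕ}
    (Rx : Matrix (Fin n) (Fin n) ℝ) (Ru : Matrix (Fin m) (Fin m) ℝ)
    (hRx : (Rx - 1).PosSemidef) (hRu : (Ru - 1).PosSemidef)
    (A : Matrix (Fin n) (Fin n) ℝ) (B : Matrix (Fin n) (Fin m) ℝ)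
    (hAB : LQR.IsStabilizable A B)
    (A' : Matrix (Fin n) (Fin n) ℝ) (B' : Matrix (Fin n) (Fin m) ℝ)
    (P : Matrix (Fin n) (Fin n) ℝ) (hP : P = LQR.PInf Rx Ru A B)
    (K : Matrix (Fin m) (Fin n) ℝ) (hK : K = LQR.KInf Rx Ru A B)
    (ε : LQR.NormKind → ℝ) (hε : ∀ c, ε c = LQR.sysDist c A B A' B')
    (α : ℝ) (hα : α = 8 * LQR.opNorm P ^ 2 * ε .op) (hα1 : α < 1) :
    LQR.IsStabilizable A' B' ∧
    (∃! P', LQR.IsDARESolution Rx Ru A' B' P') ∧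
    LQR.opNorm (LQR.PInf Rx Ru A' B') ≤ (1 - α) ^ (-(1 / 2) : ℝ) * LQR.opNorm P ∧
    (∀ c : LQR.NormKind,
      LQR.matNorm c (LQR.KInf Rx Ru A' B' - K) ≤
        7 * (1 - α) ^ (-(7 / 4) : ℝ) * LQR.opNorm P ^ (7 / 2 : ℝ) * ε c ∧
      LQR.matNorm c (LQR.psdSqrt Ru * (LQR.KInf Rx Ru A' B' - K)) ≤
        7 * (1 - α) ^ (-(7 / 4) : ℝ) * LQR.opNorm P ^ (7 / 2 : ℝ) * ε c ∧
      LQR.matNorm c (B * (LQR.KInf Rx Ru A' B' - K)) ≤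
        8 * (1 - α) ^ (-(7 / 4) : ℝ) * LQR.opNorm P ^ (7 / 2 : ℝ) * ε c ∧
      (ε .op ≤ 32 * LQR.opNorm P ^ 3 →
        LQR.matNorm c (LQR.psdSqrt P * B * (LQR.KInf Rx Ru A' B' - K)) ≤
          9 * (1 - α) ^ (-(7 / 4) : ℝ) * LQR.opNorm P ^ (7 / 2 : ℝ) * ε c)) := by
  obtain rfl : ε = fun c => LQR.sysDist c A B A' B' := funext hε
  have hRx1 : 1 ≤ Rx := hRx
  have hRu1 : 1 ≤ Ru := hRu
  have h : LQR.IsDARESolution Rx Ru A B P := by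
    rw [hP]
    exact LQR.isDARESolution_PInf (hAB.existsUnique_isDARESolution hRx1 hRu1).exists
  obtain ⟨hX0, hX⟩ := h.exists_policyOp_le hRx1 hRu1 hα hα1
  have hex := LQR.existsUnique_isDARESolution hRx1 hRu1 hX0 hX
  have h' := LQR.isDARESolution_PInf hex.exists
  have hle := h.opNorm_le hRx1 hRu1 h' hα hα1
  refine ⟨LQR.isStabilizable_of_policyOp_le hRx1 hRu1 hX0 hX, hex, hle, fun c => ?_⟩
  have hKg : K = LQR.gain Ru A B P := by rw [hK, hP]; rfl
  have hKg' : LQR.KInf Rx Ru A' B' = LQR.gain Ru A' B' (LQR.PInf Rx Ru A' B') := rfl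
  have h1α : 0 < 1 - α := by linarith
  have he : ∀ c, 0 ≤ LQR.sysDist c A B A' B' := fun c => LQR.sysDist_nonneg c A A' B B'
  rcases isEmpty_or_nonempty (Fin n) with hn | hn
  -- For `n = 0` every matrix to be bounded has no columns.
  · have hz : ∀ {k : ℕ} (X : Matrix (Fin k) (Fin n) ℝ), LQR.matNorm c X = 0 := fun X => by
      rw [Subsingleton.elim X 0, LQR.matNorm_zero]
    have hp := LQR.opNorm_nonneg P
    have := he c
    rw [hz, hz, hz, hz]
    refine ⟨?_, ?_, ?_, fun _ => ?_⟩ <;> positivity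
  rw [hKg, hKg']
  generalize LQR.PInf Rx Ru A' B' = P' at *
  have hp := LQR.one_le_opNorm (h.one_le hRx1 hRu1)
  have hp' := LQR.one_le_opNorm (h'.one_le hRx1 hRu1)
  have hs : LQR.opNorm P = Real.sqrt (LQR.opNorm P) ^ 2 :=
    (Real.sq_sqrt (LQR.opNorm_nonneg P)).symm
  have ht : LQR.opNorm P' = Real.sqrt (LQR.opNorm P') ^ 2 :=
    (Real.sq_sqrt (LQR.opNorm_nonneg P')).symm
  have heo : LQR.sysDist .op A B A' B' ≤ 1 / 8 := by
    have h1 : 1 ≤ LQR.opNorm P ^ 2 := one_le_pow₀ hp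
    have h2 := le_mul_of_one_le_left (he .op) h1
    linarith
  have hα0 : 0 ≤ α := by rw [hα]; have := he .op; positivity
  -- With `u = (1 - α)^(-1/4)` and `s = √‖P‖` the fractional powers become natural powers `u²`,
  -- `u⁷`, `s⁷`, and the bound on `‖P'‖` reads `t ≤ u s`.
  have hu1 : (1 : ℝ) ≤ (1 - α) ^ (-(1 / 4) : ℝ) :=
    Real.one_le_rpow_of_pos_of_le_one_of_nonpos h1α (by linarith) (by norm_num)
  have hu2 : (1 - α) ^ (-(1 / 2) : ℝ) = ((1 - α) ^ (-(1 / 4) : ℝ)) ^ 2 := by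
    rw [← Real.rpow_mul_natCast h1α.le]; norm_num
  have hu7 : (1 - α) ^ (-(7 / 4) : ℝ) = ((1 - α) ^ (-(1 / 4) : ℝ)) ^ 7 := by
    rw [← Real.rpow_mul_natCast h1α.le]; norm_num
  have hs7 : LQR.opNorm P ^ (7 / 2 : ℝ) = Real.sqrt (LQR.opNorm P) ^ 7 := by
    rw [Real.sqrt_eq_rpow, ← Real.rpow_mul_natCast (LQR.opNorm_nonneg P)]; norm_num
  have htu : Real.sqrt (LQR.opNorm P') ≤
      (1 - α) ^ (-(1 / 4) : ℝ) * Real.sqrt (LQR.opNorm P) := by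
    refine Real.sqrt_le_iff.mpr ⟨by positivity, ?_⟩
    rw [mul_pow, ← hs, ← hu2]
    exact hle
  obtain ⟨g1, g2, g3, g4⟩ := h.matNorm_gain_sub_le hRx1 hRu1 h' (Real.one_le_sqrt.mpr hp)
    (Real.one_le_sqrt.mpr hp') hu1 hs ht htu heo c
  rw [hu7, hs7]
  exact ⟨g1, g2, g3, fun _ => g4⟩
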